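/- Write $[m]=\{1,\dots,m\}$, and for a finite set $I$ of positive integers let $\lambda_I$ be the order-preserving bijection from $[|I|]$ to $I$. A *well-labelled Motzkin path* of size $n$ is a pair $(\mathbf p,\sigma)$ where $\mathbf p=p_1\cdots p_{n-1}$ is a word on $\{-1,0,1\}$ and $\sigma=\sigma_1\cdots\sigma_n$ is a permutation of $[n]$, such that $p_i=-1$ implies $\sigma_i<\sigma_{i+1}$, $p_i=1$ implies $\sigma_i>\sigma_{i+1}$, $\sum_{i=1}^{j}p_i\ge 0$ for $1\le j\le n-2$, and $\sum_{i=1}^{n-1}p_i=-1$. Its horizontal steps are the letters $0$ of $\mathbf p$. A *labelled binary tree* with $n$ leaves is a rooted tree whose $n$ leaves have different labels in $[n]$ and whose (unlabelled) internal vertices each have exactly two unordered children; a leaf is *single* if its sibling is an internal vertex. A *matching* on $[m]$ is a fixed-point free involution $\pi$ of $[m]$. The mapping $\Phi$, from well-labelled Motzkin paths of size $n\ge 2$ to labelled binary trees with $n$ leaves, is defined recursively. 1. If $n=2$ (so $\mathbf p=-1$ and $\sigma=12$), $\Phi(\mathbf p,\sigma)$ is the unique labelled binary tree with 2 leaves.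 2. If $n>2$ and $p_1=0$, let $J=[n]\setminus\{\sigma_1\}$, $\mathbf p'=p_2\cdots p_{n-1}$ and $\sigma'_i=\lambda_J^{-1}(\sigma_{i+1})$ for $1\le i\le n-1$. Then $\Phi(\mathbf p,\sigma)$ consists of a root and two subtrees: a leaf labelled $\sigma_1$, and $\Phi(\mathbf p',\sigma')$ with its leaves relabelled by $\lambda_J$. 3. If $n>2$ and $p_1=1$, let $k_0$ be the least $k\ge 1$ with $\sum_{i=1}^{k}p_i=0$, let $I'=\{\sigma_1,\dots,\sigma_{k_0}\}$, $I''=\{\sigma_{k_0+1},\dots,\sigma_n\}$, $p'_i=-p_{k_0-i}$ for $1\le i\le k_0-1$, $p''_i=p_{k_0+i}$ for $1\le i\le n-k_0-1$, $\sigma'_i=\lambda_{I'}^{-1}(\sigma_{k_0+1-i})$ for $1\le i\le k_0$, and $\sigma''_i=\lambda_{I''}^{-1}(\sigma_{k_0+i})$ for $1\le i\le n-k_0$. Then $\Phi(\mathbf p,\sigma)$ consists of a root and two subtrees: $\Phi(\mathbf p',\sigma')$ relabelled by $\lambda_{I'}$, and $\Phi(\mathbf p'',\sigma'')$ relabelled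 by $\lambda_{I''}$. The mapping $\Psi$, from labelled binary trees with $n\ge2$ leaves to matchings on $[2n-2]$, is defined as follows. While some non-root vertex of $\tau$ is unlabelled, consider the unlabelled non-root vertices both of whose children are labelled; among these take the vertex having the child with least label, and give it the least label of $\{n+1,\dots,2n-2\}$ not yet used. When all non-root vertices are labelled, $\pi=\Psi(\tau)$ is given by $\pi(i)=j$ for all labels $i,j$ of sibling vertices. **Theorem.** For all integers $n\ge 2$ and $k\ge 0$, the mapping $\Phi$ restricts to a bijection from the set of well-labelled Motzkin paths of size $n$ with $k$ horizontal steps onto the set of labelled binary trees with $n$ leaves, $k$ of which are single, and $\Psi$ restricts to a bijection from the latter set onto the set of matchings on $[2n-2]$ having exactly $k$ pairs $(i,j)$ with $i\in\{1,\dots,n\}$ and $j\in\{n+1,\dots,2n-2\}$. -/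

import Mathlib

namespace LabelledPaths

/-! ### Well-labelled paths -/

/-- A word `p = p₁ ⋯ pₙ₋₁` of integers together with a word `σ = σ₁ ⋯ σₙ` of labels
(indices start at 1 in the text and at 0 in the lists). -/
@[ext]
structure LPath where
  p : List ℤ
  σ : List ℕ

/-- `(p, σ)` is a well-labelled path of size `n`: `p` is a word of length `n - 1` on `{-1, 0, 1}`,
`σ` is a permutation of `[n] = {1, …, n}` in one-line notation, and `pᵢ = -1` implies
`σᵢ < σᵢ₊₁` while `pᵢ = 1` implies `σᵢ > σᵢ₊₁`. -/
structure IsWellLabelled (n : ℕ) (P : LPath) : Prop where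
  length_steps : P.p.length + 1 = n
  steps : ∀ x ∈ P.p, x = -1 ∨ x = 0 ∨ x = 1
  labels : P.σ.Perm (List.range' 1 n)
  down : ∀ i < P.p.length, P.p.getD i 0 = -1 → P.σ.getD i 0 < P.σ.getD (i + 1) 0
  up : ∀ i < P.p.length, P.p.getD i 0 = 1 → P.σ.getD (i + 1) 0 < P.σ.getD i 0

/-- Well-labelled Motzkin paths of size `n`: the partial sums `p₁ + ⋯ + pⱼ` are nonnegative for
`j = 1, …, n - 2`, and the total sum is `-1`. -/
structure IsMotzkin (n : ℕ) (P : LPath) : Prop extends IsWellLabelled n P where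
  nonneg : ∀ j, 1 ≤ j → j + 2 ≤ n → 0 ≤ (P.p.take j).sum
  total : P.p.sum = -1

/-- The number of letters `0` in `p`. -/
def LPath.horizontalSteps (P : LPath) : ℕ := P.p.count 0

/-- The well-labelled Motzkin paths of size `n` with `k` horizontal steps. -/
def motzkinPaths (n k : ℕ) : Set LPath := {P | IsMotzkin n P ∧ P.horizontalSteps = k}

/-! ### Unordered binary trees with labelled leaves -/

/-- Binary trees with labelled leaves and *ordered* children. -/
inductive PlaneTree where
  | leaf (a : ℕ) : PlaneTree
  | node (l r : PlaneTree) : PlaneTree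

namespace PlaneTree

/-- Two plane trees are equivalent if they differ only by exchanging children at some vertices. -/
inductive Equiv : PlaneTree → PlaneTree → Prop where
  | leaf (a : ℕ) : Equiv (leaf a) (leaf a)
  | node {l l' r r' : PlaneTree} : Equiv l l' → Equiv r r' → Equiv (node l r) (node l' r')
  | swap {l l' r r' : PlaneTree} : Equiv l l' → Equiv r r' → Equiv (node l r) (node r' l')

theorem Equiv.refl (t : PlaneTree) : Equiv t t := by
  induction t with
  | leaf a => exact .leaf a
  | node l r hl hr => exact .node hl hr

theorem Equiv.symm {s t : PlaneTree} (h : Equiv s t) : Equiv t s := by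
  induction h with
  | leaf a => exact .leaf a
  | node _ _ h₁ h₂ => exact .node h₁ h₂
  | swap _ _ h₁ h₂ => exact .swap h₂ h₁

theorem Equiv.trans {s t u : PlaneTree} (h : Equiv s t) (h' : Equiv t u) : Equiv s u := by
  induction h generalizing u with
  | leaf a => exact h'
  | node _ _ h₁ h₂ =>
    cases h' with
    | node k₁ k₂ => exact .node (h₁ k₁) (h₂ k₂)
    | swap k₁ k₂ => exact .swap (h₁ k₁) (h₂ k₂)
  | swap _ _ h₁ h₂ =>
    cases h' with
    | node k₁ k₂ => exact .swap (h₁ k₂) (h₂ k₁)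
    | swap k₁ k₂ => exact .node (h₁ k₂) (h₂ k₁)

instance setoid : Setoid PlaneTree := ⟨Equiv, Equiv.refl, Equiv.symm, Equiv.trans⟩

/-- The multiset of leaf labels. -/
def leafLabels : PlaneTree → Multiset ℕ
  | leaf a => {a}
  | node l r => leafLabels l + leafLabels r

theorem Equiv.leafLabels_eq {s t : PlaneTree} (h : Equiv s t) : leafLabels s = leafLabels t := by
  induction h with
  | leaf a => rfl
  | node _ _ h₁ h₂ => simp [leafLabels, h₁, h₂]
  | swap _ _ h₁ h₂ => simp [leafLabels, h₁, h₂, add_comm]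

/-- Replace each leaf labelled `i` by a leaf labelled `f i`. -/
def relabel (f : ℕ → ℕ) : PlaneTree → PlaneTree
  | leaf a => leaf (f a)
  | node l r => node (relabel f l) (relabel f r)

theorem Equiv.relabel (f : ℕ → ℕ) {s t : PlaneTree} (h : Equiv s t) :
    Equiv (relabel f s) (relabel f t) := by
  induction h with
  | leaf a => exact .leaf _
  | node _ _ h₁ h₂ => exact .node h₁ h₂
  | swap _ _ h₁ h₂ => exact .swap h₁ h₂

/-- The label of a one-leaf tree. -/
def rootLabel : PlaneTree → Option ℕ
  | leaf a => some a
  | node _ _ => none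

theorem Equiv.rootLabel_eq {s t : PlaneTree} (h : Equiv s t) : rootLabel s = rootLabel t := by
  cases h <;> rfl

end PlaneTree

/-- Rooted binary trees with labelled leaves, whose internal vertices have two *unordered*
children. -/
def BinTree : Type := Quotient PlaneTree.setoid

namespace BinTree

/-- The tree reduced to a leaf labelled `a`. -/
def leaf (a : ℕ) : BinTree := Quotient.mk _ (PlaneTree.leaf a)

/-- The tree made of a root-vertex and two (unordered) subtrees. -/
def node : BinTree → BinTree → BinTree :=
  Quotient.map₂ PlaneTree.node fun _ _ h₁ _ _ h₂ => PlaneTree.Equiv.node h₁ h₂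

theorem node_comm (s t : BinTree) : node s t = node t s := by
  induction s using Quotient.inductionOn
  induction t using Quotient.inductionOn
  exact Quotient.sound (PlaneTree.Equiv.swap (PlaneTree.Equiv.refl _) (PlaneTree.Equiv.refl _))

/-- The multiset of leaf labels. -/
def leafLabels : BinTree → Multiset ℕ :=
  Quotient.lift PlaneTree.leafLabels fun _ _ h => PlaneTree.Equiv.leafLabels_eq h

/-- Replace each leaf labelled `i` by a leaf labelled `f i`. -/
def relabel (f : ℕ → ℕ) : BinTree → BinTree :=
  Quotient.map (PlaneTree.relabel f) fun _ _ h => PlaneTree.Equiv.relabel f h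

/-- The label of a leaf; an internal vertex has none. -/
def rootLabel : BinTree → Option ℕ :=
  Quotient.lift PlaneTree.rootLabel fun _ _ h => PlaneTree.Equiv.rootLabel_eq h

/-- A labelled binary tree of size `n`: it has `n` leaves, with `n` different labels in `[n]`. -/
def IsLabelled (n : ℕ) (τ : BinTree) : Prop := τ.leafLabels = (Finset.Icc 1 n).val

/-- `IsVertex v τ`: `v` is the subtree of `τ` hanging at some vertex. Since the leaves of a
labelled binary tree have different labels, different vertices carry different subtrees,
and so a vertex is identified with the subtree hanging at it. -/
inductive IsVertex : BinTree → BinTree → Prop where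
  | root (τ : BinTree) : IsVertex τ τ
  | left {v s : BinTree} (t : BinTree) : IsVertex v s → IsVertex v (node s t)
  | right {v t : BinTree} (s : BinTree) : IsVertex v t → IsVertex v (node s t)

/-- The (labels of the) single leaves, those whose sibling is an internal vertex. -/
def singleLeaves (τ : BinTree) : Set ℕ :=
  {a | ∃ s t : BinTree, IsVertex (node (leaf a) (node s t)) τ}

end BinTree

open BinTree

/-- The labelled binary trees with `n` leaves, `k` of which are single leaves. -/
def labelledTrees (n k : ℕ) : Set BinTree :=
  {τ | τ.IsLabelled n ∧ τ.singleLeaves.ncard = k}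

/-! ### The mapping `Φ` from paths to trees -/

/-- `λ_I`, the order preserving bijection from `[|I|] = {1, …, |I|}` to `I`. -/
noncomputable def lam (I : Finset ℕ) (i : ℕ) : ℕ := Nat.nth (· ∈ I) (i - 1)

/-- `λ_I⁻¹`, the inverse bijection from `I` to `[|I|]`: the rank of `x` in `I`. -/
def lamInv (I : Finset ℕ) (x : ℕ) : ℕ := Nat.count (· ∈ I) x + 1

open Classical in
/-- The mapping `Φ`, with its three cases (i) `α₂ ↦ τ₂`, (ii) `p₁ = 0` and (iii) `p₁ = 1`.
The value on words that are not Motzkin paths is irrelevant. -/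
noncomputable def PhiAux : List ℤ → List ℕ → BinTree
  | [], _ => leaf 0
  | x :: q, σ =>
    if x :: q = [-1] then node (leaf 1) (leaf 2)
    else if x = 0 then
      let a := σ.headD 0
      let J := (Finset.Icc 1 σ.length).erase a
      node (leaf a) (relabel (lam J) (PhiAux q (σ.tail.map (lamInv J))))
    else if h : x = 1 ∧ ∃ k, 1 ≤ k ∧ k ≤ (x :: q).length ∧ ((x :: q).take k).sum = 0 then
      let k := Nat.find h.2
      let I' := (σ.take k).toFinset
      let I'' := (σ.drop k).toFinset
      let p' := (((x :: q).take (k - 1)).map fun y => -y).reverse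
      let p'' := (x :: q).drop k
      let σ' := (σ.take k).reverse.map (lamInv I')
      let σ'' := (σ.drop k).map (lamInv I'')
      node (relabel (lam I') (PhiAux p' σ')) (relabel (lam I'') (PhiAux p'' σ''))
    else leaf 0
termination_by p => p.length
decreasing_by
  · simp
  · have := Nat.find_spec h.2
    simp only [List.length_map, List.length_reverse, List.length_take]; omega
  · have := Nat.find_spec h.2
    simp only [List.length_drop]; omega

/-- The mapping `Φ` from well-labelled Motzkin paths to labelled binary trees. -/
noncomputable def Phi (P : LPath) : BinTree := PhiAux P.p P.σ

/-! ### The mapping `Ψ` from trees to matchings -/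

/-- Given a partial labelling `ℓ` of the vertices of `τ`, the vertex `v` is a non-root unlabelled
vertex with both children labelled, and `m` is the least label of its children. -/
def Ready (τ : BinTree) (ℓ : BinTree → Option ℕ) (v : BinTree) (m : ℕ) : Prop :=
  IsVertex v τ ∧ v ≠ τ ∧ ℓ v = none ∧
    ∃ (s t : BinTree) (a b : ℕ), v = node s t ∧ ℓ s = some a ∧ ℓ t = some b ∧ m = min a b

/-- `v` is, among the ready vertices, the one which has the child with least label. -/
def IsNext (τ : BinTree) (ℓ : BinTree → Option ℕ) (v : BinTree) : Prop :=
  ∃ m, Ready τ ℓ v m ∧ ∀ v' m', Ready τ ℓ v' m' → m ≤ m'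

open Classical in
/-- The partial labelling of the vertices of `τ` after `i` steps of the procedure. Initially only
the leaves are labelled; the `(i + 1)`-st step attributes the label `n + 1 + i`, the least label
in `[2n - 2] \ [n]` not yet attributed. -/
noncomputable def labelling (n : ℕ) (τ : BinTree) : ℕ → BinTree → Option ℕ
  | 0 => rootLabel
  | i + 1 =>
    if h : ∃ v, IsNext τ (labelling n τ i) v then
      Function.update (labelling n τ i) h.choose (some (n + 1 + i))
    else labelling n τ i

/-- The full labelling, obtained once the `n - 2` internal non-root vertices are labelled. -/
noncomputable def fullLabelling (n : ℕ) (τ : BinTree) : BinTree → Option ℕ := labelling n τ (n - 2)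

/-- `i` and `j` are the labels of siblings in the fully labelled tree. -/
def SiblingLabels (n : ℕ) (τ : BinTree) (i j : ℕ) : Prop :=
  ∃ s t : BinTree, IsVertex (node s t) τ ∧
    fullLabelling n τ s = some i ∧ fullLabelling n τ t = some j

open Classical in
/-- The mapping `Ψ`: the matching `π = Ψ(τ)` on `[2n - 2]` is given by `π(i) = j` for all pairs
`i, j` of labels of siblings in the fully labelled tree. -/
noncomputable def Psi (n : ℕ) (τ : BinTree) :
    Set.Icc 1 (2 * n - 2) → Set.Icc 1 (2 * n - 2) := fun i =>
  if h : ∃ j : Set.Icc 1 (2 * n - 2), SiblingLabels n τ i j then h.choose else i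

/-! ### Matchings -/

/-- Matchings on `[m]`, that is, fixed-point free involutions. -/
def IsMatching (m : ℕ) (π : Set.Icc 1 m → Set.Icc 1 m) : Prop :=
  Function.Involutive π ∧ ∀ i, π i ≠ i

/-- The pairs `(i, j)` of the matching `π` with `i ∈ {1, …, n}` and `j ∈ {n + 1, …, m}`. -/
def crossPairs (n m : ℕ) (π : Set.Icc 1 m → Set.Icc 1 m) : Set (Set.Icc 1 m × Set.Icc 1 m) :=
  {q | π q.1 = q.2 ∧ (q.1 : ℕ) ≤ n ∧ n + 1 ≤ (q.2 : ℕ)}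

/-- The matchings on `[2n - 2]` having `k` pairs `(i, j)` such that `i ∈ {1, …, n}` and
`j ∈ {n + 1, …, 2n - 2}`. -/
def matchings (n k : ℕ) : Set (Set.Icc 1 (2 * n - 2) → Set.Icc 1 (2 * n - 2)) :=
  {π | IsMatching (2 * n - 2) π ∧ (crossPairs n (2 * n - 2) π).ncard = k}

end LabelledPaths

/-! For `Φ`, the recursion is reversible. The relation `Codes p σ τ` runs it on arbitrary different
labels, which removes the standardisation at each step. A Motzkin word is `[-1]`, or `0` followed by
a Motzkin word, or begins with `1`; in the last case, cutting at the first return to height `0`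
writes it as `negRev p ++ -1 :: q` with `p` and `q` Motzkin words, and the down-step of the cut says
that the first labels of the two pieces are in increasing order. Conversely, if a tree is not a
leaf, then the number of leaves among the children of the root (two, one or none) tells which case
occurred, and when there is none, comparing first labels tells which subtree plays the role of `p`.
Hence `exists_codes`, `exists_codes_of_nodup` and `Codes.unique`; `Codes.PhiAux_map` connects the
relation with `Φ` itself. Each letter `0` corresponds to a single leaf.

For `Ψ`, trees and matchings are both encoded by the same object, a `Greedy` sequence of pairs `(a
v, b v)`, `n < v < 2 * n`, the labels of the children of the vertex labelled `v`. Such a sequence is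
determined by its set of pairs (`Greedy.unique`), since the greedy rule forces the order in which
they are used. It exists for every labelled tree and for every matching, because counting shows that
some pair is always available. By `IsForest.isNext_iff` the labelling procedure finds exactly these
labels, so `Ψ` forgets the order of the pairs, and nothing is lost. Single leaves are the pairs with
`a v ≤ n < b v`. -/

namespace LabelledPaths

/-! ### Generalities on unordered binary trees -/

namespace BinTree

theorem induction {motive : BinTree → Prop} (leaf : ∀ a, motive (leaf a))
    (node : ∀ s t, motive s → motive t → motive (node s t)) (τ : BinTree) : motive τ := by
  induction τ using Quotient.inductionOn with
  | h τ =>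
    induction τ with
    | leaf a => exact leaf a
    | node l r hl hr => exact node _ _ hl hr

theorem leaf_injective : Function.Injective leaf := by
  intro a b h
  cases Quotient.exact h
  rfl

@[simp] theorem leaf_inj {a b : ℕ} : leaf a = leaf b ↔ a = b := leaf_injective.eq_iff

@[simp] theorem leaf_ne_node (a : ℕ) (s t : BinTree) : leaf a ≠ node s t := by
  induction s using Quotient.inductionOn
  induction t using Quotient.inductionOn
  intro h
  cases Quotient.exact h

@[simp] theorem node_ne_leaf (a : ℕ) (s t : BinTree) : node s t ≠ leaf a :=
  (leaf_ne_node a s t).symm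

theorem node_eq_node {s t s' t' : BinTree} :
    node s t = node s' t' ↔ (s = s' ∧ t = t') ∨ (s = t' ∧ t = s') := by
  constructor
  · induction s using Quotient.inductionOn
    induction t using Quotient.inductionOn
    induction s' using Quotient.inductionOn
    induction t' using Quotient.inductionOn
    intro h
    cases Quotient.exact h with
    | node h₁ h₂ => exact .inl ⟨Quotient.sound h₁, Quotient.sound h₂⟩
    | swap h₁ h₂ => exact .inr ⟨Quotient.sound h₁, Quotient.sound h₂⟩
  · rintro (⟨rfl, rfl⟩ | ⟨rfl, rfl⟩)
    · rfl
    · exact node_comm _ _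

@[simp] theorem leafLabels_leaf (a : ℕ) : leafLabels (leaf a) = {a} := rfl

@[simp] theorem leafLabels_node (s t : BinTree) :
    leafLabels (node s t) = leafLabels s + leafLabels t := by
  induction s using Quotient.inductionOn
  induction t using Quotient.inductionOn
  rfl

@[simp] theorem relabel_leaf (f : ℕ → ℕ) (a : ℕ) : relabel f (leaf a) = leaf (f a) := rfl

@[simp] theorem relabel_node (f : ℕ → ℕ) (s t : BinTree) :
    relabel f (node s t) = node (relabel f s) (relabel f t) := by
  induction s using Quotient.inductionOn
  induction t using Quotient.inductionOn
  rfl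

@[simp] theorem rootLabel_leaf (a : ℕ) : rootLabel (leaf a) = some a := rfl

@[simp] theorem rootLabel_node (s t : BinTree) : rootLabel (node s t) = none := by
  induction s using Quotient.inductionOn
  induction t using Quotient.inductionOn
  rfl

theorem relabel_relabel (f g : ℕ → ℕ) (τ : BinTree) :
    relabel f (relabel g τ) = relabel (f ∘ g) τ := by
  induction τ using induction with
  | leaf a => rfl
  | node s t hs ht => simp [hs, ht]

theorem relabel_congr {f g : ℕ → ℕ} {τ : BinTree} (h : ∀ x ∈ leafLabels τ, f x = g x) :
    relabel f τ = relabel g τ := by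
  induction τ using induction with
  | leaf a => simpa using h
  | node s t hs ht =>
    simp only [leafLabels_node, Multiset.mem_add] at h
    rw [relabel_node, relabel_node, hs fun x hx => h x (.inl hx), ht fun x hx => h x (.inr hx)]

theorem relabel_id (τ : BinTree) : relabel id τ = τ := by
  induction τ using induction with
  | leaf a => rfl
  | node s t hs ht => simp [hs, ht]

theorem leafLabels_card_pos (τ : BinTree) : 0 < τ.leafLabels.card := by
  induction τ using induction with
  | leaf a => simp
  | node s t hs ht => simp; omega

theorem exists_mem_leafLabels (τ : BinTree) : ∃ x, x ∈ τ.leafLabels :=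
  Multiset.card_pos_iff_exists_mem.1 τ.leafLabels_card_pos

/-! ### Vertices as subtrees. -/

theorem isVertex_leaf {u : BinTree} {a : ℕ} : IsVertex u (leaf a) ↔ u = leaf a := by
  constructor
  · generalize hτ : leaf a = τ
    intro h
    cases h with
    | root => rfl
    | left | right => exact absurd hτ (leaf_ne_node _ _ _)
  · rintro rfl
    exact .root _

theorem isVertex_node {u s t : BinTree} :
    IsVertex u (node s t) ↔ u = node s t ∨ IsVertex u s ∨ IsVertex u t := by
  constructor
  · generalize hτ : node s t = τ
    intro h
    cases h with
    | root => exact .inl rfl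
    | left _ h =>
      rcases node_eq_node.1 hτ with ⟨rfl, rfl⟩ | ⟨rfl, rfl⟩
      · exact .inr (.inl h)
      · exact .inr (.inr h)
    | right _ h =>
      rcases node_eq_node.1 hτ with ⟨rfl, rfl⟩ | ⟨rfl, rfl⟩
      · exact .inr (.inr h)
      · exact .inr (.inl h)
  · rintro (rfl | h | h)
    · exact .root _
    · exact .left _ h
    · exact .right _ h

theorem IsVertex.trans {u v τ : BinTree} (h : IsVertex u v) (h' : IsVertex v τ) :
    IsVertex u τ := by
  induction h' with
  | root => exact h
  | left t _ ih => exact .left t ih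
  | right s _ ih => exact .right s ih

theorem IsVertex.leafLabels_le {u τ : BinTree} (h : IsVertex u τ) :
    u.leafLabels ≤ τ.leafLabels := by
  induction h with
  | root => exact le_rfl
  | left t _ ih => simpa using ih.trans (Multiset.le_add_right _ _)
  | right s _ ih => simpa using ih.trans (Multiset.le_add_left _ _)

theorem IsVertex.mem_leafLabels {u τ : BinTree} (h : IsVertex u τ) {x : ℕ}
    (hx : x ∈ u.leafLabels) : x ∈ τ.leafLabels :=
  Multiset.mem_of_le h.leafLabels_le hx

theorem IsVertex.card_le {u τ : BinTree} (h : IsVertex u τ) :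
    u.leafLabels.card ≤ τ.leafLabels.card :=
  Multiset.card_le_card h.leafLabels_le

theorem isVertex_of_mem_leafLabels {τ : BinTree} {x : ℕ} (h : x ∈ τ.leafLabels) :
    IsVertex (leaf x) τ := by
  induction τ using induction with
  | leaf a =>
    rw [leafLabels_leaf, Multiset.mem_singleton] at h
    exact h ▸ .root _
  | node s t hs ht =>
    rw [leafLabels_node, Multiset.mem_add] at h
    exact h.elim (fun h => .left _ (hs h)) fun h => .right _ (ht h)

theorem disjoint_of_nodup_node {s t : BinTree} (h : (node s t).leafLabels.Nodup) :
    Disjoint s.leafLabels t.leafLabels := by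
  rw [leafLabels_node] at h
  exact (Multiset.nodup_add.1 h).2.2

theorem nodup_left {s t : BinTree} (h : (node s t).leafLabels.Nodup) : s.leafLabels.Nodup :=
  (Multiset.nodup_add.1 (leafLabels_node s t ▸ h)).1

theorem nodup_right {s t : BinTree} (h : (node s t).leafLabels.Nodup) : t.leafLabels.Nodup :=
  (Multiset.nodup_add.1 (leafLabels_node s t ▸ h)).2.1

/-- Every subtree has a leaf, whose label cannot occur on both sides. This is what allows a vertex
to be identified with the subtree hanging at it. -/
theorem not_isVertex_both {s t u : BinTree} (h : (node s t).leafLabels.Nodup)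
    (hs : IsVertex u s) (ht : IsVertex u t) : False := by
  obtain ⟨x, hx⟩ := u.exists_mem_leafLabels
  exact Multiset.disjoint_left.1 (disjoint_of_nodup_node h) (hs.mem_leafLabels hx)
    (ht.mem_leafLabels hx)

theorem isVertex_left_child (s t : BinTree) : IsVertex s (node s t) := .left _ (.root _)

theorem isVertex_right_child (s t : BinTree) : IsVertex t (node s t) := .right _ (.root _)

theorem not_isVertex_node_left (s t : BinTree) : ¬ IsVertex (node s t) s := by
  intro h
  have h₁ := h.card_le
  have h₂ := t.leafLabels_card_pos
  rw [leafLabels_node, Multiset.card_add] at h₁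
  omega

/-- If the labels are different, a vertex has only one sibling. -/
theorem IsVertex.sibling_unique {τ s t t' : BinTree} (hτ : τ.leafLabels.Nodup)
    (h : IsVertex (node s t) τ) (h' : IsVertex (node s t') τ) : t = t' := by
  induction τ using induction with
  | leaf a => exact absurd (isVertex_leaf.1 h) (node_ne_leaf _ _ _)
  | node l r hl hr =>
    -- A child `s` of the root cannot also have a parent strictly inside the tree: it would contain
    -- that parent, or occur in both subtrees.
    have key : ∀ {t t' : BinTree}, node s t = node l r →
        (IsVertex (node s t') l ∨ IsVertex (node s t') r) → False := by
      intro t t' h h'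
      rcases node_eq_node.1 h with ⟨rfl, rfl⟩ | ⟨rfl, rfl⟩ <;> rcases h' with h' | h'
      · exact not_isVertex_node_left _ _ h'
      · exact not_isVertex_both hτ (.root _) ((isVertex_left_child _ _).trans h')
      · exact not_isVertex_both hτ ((isVertex_left_child _ _).trans h') (.root _)
      · exact not_isVertex_node_left _ _ h'
    rcases isVertex_node.1 h with h | h <;> rcases isVertex_node.1 h' with h' | h'
    · rcases node_eq_node.1 (h.trans h'.symm) with ⟨-, h⟩ | ⟨h₁, h₂⟩
      · exact h
      · exact h₂.trans h₁
    · exact (key h h').elim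
    · exact (key h' h).elim
    · rcases h with h | h <;> rcases h' with h' | h'
      · exact hl (nodup_left hτ) h h'
      · exact (not_isVertex_both hτ ((isVertex_left_child _ _).trans h)
          ((isVertex_left_child _ _).trans h')).elim
      · exact (not_isVertex_both hτ ((isVertex_left_child _ _).trans h')
          ((isVertex_left_child _ _).trans h)).elim
      · exact hr (nodup_right hτ) h h'

open Classical in
/-- A binary tree with `n` leaves has `2 * n - 1` vertices. -/
theorem exists_finset_vertices {τ : BinTree} (hτ : τ.leafLabels.Nodup) :
    ∃ V : Finset BinTree, (∀ u, u ∈ V ↔ IsVertex u τ) ∧ V.card + 1 = 2 * τ.leafLabels.card := by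
  induction τ using induction with
  | leaf a => exact ⟨{leaf a}, fun u => by simp [isVertex_leaf], by simp⟩
  | node s t hs ht =>
    obtain ⟨V, hV, hVc⟩ := hs (nodup_left hτ)
    obtain ⟨W, hW, hWc⟩ := ht (nodup_right hτ)
    refine ⟨insert (node s t) (V ∪ W), fun u => by simp [isVertex_node, hV, hW], ?_⟩
    rw [Finset.card_insert_of_notMem, Finset.card_union_of_disjoint]
    · simp; omega
    · rw [Finset.disjoint_left]
      exact fun u h h' => not_isVertex_both hτ ((hV u).1 h) ((hW u).1 h')
    · rw [Finset.mem_union, hV, hW]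
      rintro (h | h)
      · exact not_isVertex_node_left _ _ h
      · exact not_isVertex_node_left _ _ (node_comm s t ▸ h)

theorem IsLabelled.nodup {n : ℕ} {τ : BinTree} (h : IsLabelled n τ) : τ.leafLabels.Nodup := by
  rw [h]
  exact Finset.nodup _

theorem IsLabelled.mem_iff {n : ℕ} {τ : BinTree} (h : IsLabelled n τ) (x : ℕ) :
    x ∈ τ.leafLabels ↔ 1 ≤ x ∧ x ≤ n := by
  rw [h, Finset.mem_val, Finset.mem_Icc]

theorem IsLabelled.card {n : ℕ} {τ : BinTree} (h : IsLabelled n τ) : τ.leafLabels.card = n := by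
  rw [h, Finset.card_val, Nat.card_Icc, Nat.add_sub_cancel]

end BinTree

open BinTree

/-! ### Words of steps and their labels -/

/-- The condition on the labels `a`, `b` of the two ends of a step `x`. -/
def StepRel (x : ℤ) (a b : ℕ) : Prop := (x = -1 → a < b) ∧ (x = 1 → b < a)

theorem StepRel.neg {x : ℤ} {a b : ℕ} (h : StepRel x a b) : StepRel (-x) b a :=
  ⟨fun hx => h.2 (by omega), fun hx => h.1 (by omega)⟩

/-- The word `σ` has one more letter than `p`, and consecutive letters of `σ` satisfy the
condition given by `p`. -/
def Compat : List ℤ → List ℕ → Prop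
  | [], [_] => True
  | x :: p, a :: b :: σ => StepRel x a b ∧ Compat p (b :: σ)
  | _, _ => False

theorem Compat.length {p : List ℤ} {σ : List ℕ} (h : Compat p σ) : σ.length = p.length + 1 := by
  induction p generalizing σ with
  | nil =>
    match σ, h with
    | [_], _ => rfl
  | cons x p ih =>
    match σ, h with
    | a :: b :: σ, h => simpa using ih h.2

theorem compat_iff {p : List ℤ} {σ : List ℕ} : Compat p σ ↔ σ.length = p.length + 1 ∧
    ∀ i < p.length, StepRel (p.getD i 0) (σ.getD i 0) (σ.getD (i + 1) 0) := by
  induction p generalizing σ with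
  | nil =>
    match σ with
    | [] => simp [Compat]
    | [_] => simp [Compat]
    | _ :: _ :: _ => simp [Compat]
  | cons x p ih =>
    match σ with
    | [] => simp [Compat]
    | [_] => simp [Compat]
    | a :: b :: σ =>
      simp only [Compat, ih, List.length_cons, Nat.forall_lt_succ_left', List.getD_cons_zero,
        List.getD_cons_succ, Nat.add_right_cancel_iff]
      tauto

/-- The letter `x` is the step from the last letter of `σ` to the first letter of `ρ`. The default
`0` of `headD` is harmless: `σ` is nonempty by `h`, and for empty `ρ` both sides are false. -/
theorem compat_append {p q : List ℤ} {σ ρ : List ℕ} {x : ℤ} (h : σ.length = p.length + 1) :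
    Compat (p ++ x :: q) (σ ++ ρ) ↔
      Compat p σ ∧ StepRel x (σ.reverse.headD 0) (ρ.headD 0) ∧ Compat q ρ := by
  induction p generalizing σ with
  | nil =>
    match σ, h with
    | [c], _ =>
      match ρ with
      | [] => cases q <;> simp [Compat]
      | d :: ρ => simp [Compat]
  | cons y p ih =>
    match σ, h with
    | a :: b :: σ, h =>
      have ih' := @ih (b :: σ) (by simpa using h)
      have hd : (a :: b :: σ).reverse.headD 0 = (b :: σ).reverse.headD 0 := by
        simp [List.headD_eq_head?_getD]
      rw [hd]
      simp only [List.cons_append, Compat] at ih' ⊢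
      rw [ih']
      tauto

/-- The word of the path described by `p` read backwards. -/
def negRev (p : List ℤ) : List ℤ := (p.map fun y => -y).reverse

@[simp] theorem length_negRev (p : List ℤ) : (negRev p).length = p.length := by simp [negRev]

@[simp] theorem negRev_negRev (p : List ℤ) : negRev (negRev p) = p := by simp [negRev]

theorem Compat.negRev {p : List ℤ} {σ : List ℕ} (h : Compat p σ) :
    Compat (negRev p) σ.reverse := by
  induction p generalizing σ with
  | nil =>
    match σ, h with
    | [_], _ => trivial
  | cons x p ih =>
    match σ, h with
    | a :: b :: σ, h =>
      have h₁ : LabelledPaths.negRev (x :: p) = LabelledPaths.negRev p ++ -x :: [] := by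
        simp [LabelledPaths.negRev]
      have h₂ : (a :: b :: σ).reverse = (b :: σ).reverse ++ [a] := by simp
      rw [h₁, h₂, compat_append (by simpa using h.2.length)]
      exact ⟨ih h.2, by simpa using h.1.neg, trivial⟩

/-- The first `j` steps read backwards are the negatives of the last `j` steps of `p`. -/
theorem sum_take_negRev (p : List ℤ) (j : ℕ) :
    ((negRev p).take j).sum = (p.take (p.length - j)).sum - p.sum := by
  have h := List.sum_take_add_sum_drop p (p.length - j)
  rw [negRev, List.take_reverse, List.sum_reverse, List.length_map, ← List.map_drop]
  have : ((p.drop (p.length - j)).map fun y => -y).sum = -(p.drop (p.length - j)).sum := by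
    generalize p.drop (p.length - j) = l
    induction l with
    | nil => rfl
    | cons a l ih => simp [ih]; ring
  rw [this]
  linarith

theorem count_zero_negRev (p : List ℤ) : (negRev p).count 0 = p.count 0 := by
  rw [negRev, List.count_reverse]
  induction p with
  | nil => rfl
  | cons x p ih => simp [List.count_cons, ih]

/-- The words of steps of Motzkin paths. -/
structure IsMotzkinWord (p : List ℤ) : Prop where
  steps : ∀ x ∈ p, x = -1 ∨ x = 0 ∨ x = 1
  nonneg : ∀ j < p.length, 0 ≤ (p.take j).sum
  total : p.sum = -1

/-- Separating steps from labels lets words be cut without reference to `n` or to the set of labels.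
The range `j < p.length` is `j ≤ n - 2`, with the trivial case `j = 0` added. -/
theorem isMotzkin_iff {n : ℕ} {P : LPath} : IsMotzkin n P ↔
    P.p.length + 1 = n ∧ IsMotzkinWord P.p ∧ Compat P.p P.σ ∧ P.σ.Perm (List.range' 1 n) := by
  constructor
  · intro h
    have hl := h.labels.length_eq
    have hn := h.length_steps
    refine ⟨hn, ⟨h.steps, fun j hj => ?_, h.total⟩, compat_iff.2 ⟨?_, fun i hi =>
      ⟨h.down i hi, h.up i hi⟩⟩, h.labels⟩
    · rcases Nat.eq_zero_or_pos j with rfl | hj'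
      · simp
      · exact h.nonneg j hj' (by omega)
    · rw [hl, List.length_range', hn]
  · rintro ⟨hn, hp, hc, hσ⟩
    have hc' := (compat_iff.1 hc).2
    exact ⟨⟨hn, hp.steps, hσ, fun i hi => (hc' i hi).1, fun i hi => (hc' i hi).2⟩,
      fun j _ hj => hp.nonneg j (by omega), hp.total⟩

theorem IsMotzkinWord.ne_nil {p : List ℤ} (h : IsMotzkinWord p) : p ≠ [] := by
  rintro rfl
  simpa using h.total

theorem isMotzkinWord_singleton : IsMotzkinWord [-1] := by
  refine ⟨by simp, fun j hj => ?_, by simp⟩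
  obtain rfl : j = 0 := by simpa using hj
  simp

theorem isMotzkinWord_zero_cons {p : List ℤ} : IsMotzkinWord (0 :: p) ↔ IsMotzkinWord p := by
  constructor
  · intro h
    refine ⟨fun x hx => h.steps x (List.mem_cons_of_mem _ hx), fun j hj => ?_, ?_⟩
    · simpa using h.nonneg (j + 1) (by simpa using hj)
    · simpa using h.total
  · intro h
    refine ⟨by simpa using h.steps, fun j hj => ?_, by simpa using h.total⟩
    cases j with
    | zero => simp
    | succ j => simpa using h.nonneg j (by simpa using hj)

/-! ### Motzkin words starting with an up-step. -/

theorem IsMotzkinWord.sum_take_fork_of_le {p q : List ℤ} (hp : IsMotzkinWord p) {j : ℕ}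
    (hj : j ≤ p.length) :
    ((negRev p ++ -1 :: q).take j).sum = (p.take (p.length - j)).sum + 1 := by
  rw [List.take_append_of_le_length (by simpa using hj), sum_take_negRev, hp.total]
  ring

/-- Read backwards, `p` climbs from `0` to `1`; the step `-1` then returns to `0`, where `q` starts.
-/
theorem IsMotzkinWord.sum_take_fork_add {p q : List ℤ} (hp : IsMotzkinWord p) (j : ℕ) :
    ((negRev p ++ -1 :: q).take (p.length + 1 + j)).sum = (q.take j).sum := by
  have h := sum_take_negRev p p.length
  rw [hp.total] at h
  rw [List.take_append, List.sum_append, length_negRev,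
    show p.length + 1 + j - p.length = j + 1 by omega, List.take_of_length_le (by simp; omega)]
  rw [List.take_of_length_le (by simp)] at h
  simp [h]

/-- Read backwards, the heights of `p` are raised by `1`, so the word stays positive until the step
`-1`. The first return is therefore at `p.length + 1`, the `k₀` of the definition of `Φ`. -/
theorem IsMotzkinWord.one_le_sum_take_fork {p q : List ℤ} (hp : IsMotzkinWord p) {j : ℕ}
    (hj : 1 ≤ j) (hj' : j ≤ p.length) : 1 ≤ ((negRev p ++ -1 :: q).take j).sum := by
  rw [hp.sum_take_fork_of_le hj']
  have := hp.nonneg (p.length - j) (by omega)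
  omega

theorem IsMotzkinWord.fork {p q : List ℤ} (hp : IsMotzkinWord p) (hq : IsMotzkinWord q) :
    IsMotzkinWord (negRev p ++ -1 :: q) := by
  refine ⟨fun x hx => ?_, fun j hj => ?_, ?_⟩
  · simp only [negRev, List.mem_append, List.mem_reverse, List.mem_map, List.mem_cons] at hx
    rcases hx with ⟨y, hy, rfl⟩ | rfl | hx
    · rcases hp.steps y hy with rfl | rfl | rfl <;> simp
    · simp
    · exact hq.steps x hx
  · rcases Nat.eq_zero_or_pos j with rfl | hj₁
    · simp
    rcases Nat.lt_or_ge p.length j with hj₂ | hj₂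
    · obtain ⟨i, rfl⟩ := Nat.exists_eq_add_of_le hj₂
      rw [Nat.succ_eq_add_one, hp.sum_take_fork_add]
      refine hq.nonneg i ?_
      simp at hj
      omega
    · exact zero_le_one.trans (hp.one_le_sum_take_fork hj₁ hj₂)
  · have h := hp.sum_take_fork_add (q := q) q.length
    rwa [List.take_of_length_le (by simp; omega), List.take_length, hq.total] at h

theorem IsMotzkinWord.exists_fork_eq_cons {p : List ℤ} (hp : IsMotzkinWord p) (q : List ℤ) :
    ∃ r, negRev p ++ -1 :: q = 1 :: r := by
  have hpos : 1 ≤ p.length := List.length_pos_iff.2 hp.ne_nil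
  have h := hp.one_le_sum_take_fork (q := q) le_rfl hpos
  obtain ⟨x, r, hr⟩ : ∃ x r, negRev p = x :: r :=
    List.exists_cons_of_length_pos (by rw [length_negRev]; exact hpos)
  have hx : x ∈ negRev p := hr ▸ List.mem_cons_self
  simp only [negRev, List.mem_reverse, List.mem_map] at hx
  obtain ⟨y, hy, rfl⟩ := hx
  simp only [hr, List.cons_append, List.take_succ_cons, List.take_zero, List.sum_cons,
    List.sum_nil] at h
  rcases hp.steps y hy with rfl | rfl | rfl <;> simp_all

/-- The decomposition of a Motzkin path starting with an up-step at its first return. -/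
theorem IsMotzkinWord.exists_fork {r : List ℤ} (h : IsMotzkinWord (1 :: r)) :
    ∃ p q, IsMotzkinWord p ∧ IsMotzkinWord q ∧ 1 :: r = negRev p ++ -1 :: q := by
  set w := 1 :: r with hw
  have hsucc : ∀ j (hj : j < w.length), (w.take (j + 1)).sum = (w.take j).sum + w[j] :=
    fun j hj => by rw [List.take_succ_eq_append_getElem hj, List.sum_append]; simp
  have hlen : 2 ≤ w.length := by
    rcases r with _ | ⟨x, r⟩
    · exact absurd h.total (by simp [hw])
    · simp [hw]
  -- The path ends at `-1` and its last step is at least `-1`, so just before that step its height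
  -- is at most `0`, hence `0`.
  have hex : ∃ k, 1 ≤ k ∧ k < w.length ∧ (w.take k).sum = 0 := by
    refine ⟨w.length - 1, by omega, by omega, le_antisymm ?_ (h.nonneg _ (by omega))⟩
    have h₁ := hsucc (w.length - 1) (by omega)
    rw [Nat.sub_add_cancel (by omega), List.take_length, h.total] at h₁
    rcases h.steps _ (List.getElem_mem (show w.length - 1 < w.length by omega)) with h | h | h <;>
      omega
  classical
  obtain ⟨hk₁, hk₂, hk₀⟩ := Nat.find_spec hex
  have hmin := fun j => @Nat.find_min _ _ hex j
  generalize Nat.find hex = k at hk₁ hk₂ hk₀ hmin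
  obtain ⟨m, rfl⟩ := Nat.exists_eq_add_of_le' hk₁
  have hpos : ∀ j, 1 ≤ j → j ≤ m → 1 ≤ (w.take j).sum := by
    intro j hj hj'
    have h₁ := h.nonneg j (by omega)
    have h₂ := hmin j (by omega)
    have : (w.take j).sum ≠ 0 := fun h₃ => h₂ ⟨hj, by omega, h₃⟩
    omega
  have hm : 1 ≤ m := by
    rcases Nat.eq_zero_or_pos m with rfl | hm
    · simp [hw] at hk₀
    · exact hm
  have hstep := hsucc m (by omega)
  have hm₁ := hpos m hm le_rfl
  have hwm : w[m] = -1 := by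
    rcases h.steps _ (List.getElem_mem (show m < w.length by omega)) with h | h | h <;> omega
  have hsum : (w.take m).sum = 1 := by omega
  have hlm : (w.take m).length = m := by simp; omega
  -- Before the return, the path goes from `0` to `1` staying at height at least `1` after its
  -- start. Read backwards and lowered by `1`, it is a Motzkin word.
  refine ⟨negRev (w.take m), w.drop (m + 1), ⟨?_, ?_, ?_⟩, ⟨?_, ?_, ?_⟩, ?_⟩
  · intro x hx
    simp only [negRev, List.mem_reverse, List.mem_map] at hx
    obtain ⟨y, hy, rfl⟩ := hx
    rcases h.steps y (List.mem_of_mem_take hy) with rfl | rfl | rfl <;> simp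
  · intro j hj
    rw [length_negRev, hlm] at hj
    rw [sum_take_negRev, hsum, hlm, List.take_take, min_eq_left (by omega)]
    have := hpos (m - j) (by omega) (by omega)
    omega
  · have := sum_take_negRev (w.take m) m
    rw [List.take_of_length_le (by rw [length_negRev, hlm]), hlm, hsum] at this
    simpa using this
  · exact fun x hx => h.steps x (List.mem_of_mem_drop hx)
  · intro j hj
    rw [List.length_drop] at hj
    have h₁ := h.nonneg (m + 1 + j) (by omega)
    rw [List.take_add, List.sum_append, hk₀] at h₁
    omega
  · have h₁ := List.sum_take_add_sum_drop w (m + 1)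
    rw [h.total] at h₁
    omega
  · rw [negRev_negRev, ← hwm, List.cons_getElem_drop_succ, List.take_append_drop]

/-! ### The trees coded by labelled words -/

/-- `Codes p σ τ`: the mapping `Φ`, extended to words `σ` of arbitrary different labels, maps
`(p, σ)` to `τ`. -/
inductive Codes : List ℤ → List ℕ → BinTree → Prop
  | cherry {a b : ℕ} : a < b → Codes [-1] [a, b] (node (leaf a) (leaf b))
  | leaf (a : ℕ) {p : List ℤ} {σ : List ℕ} {τ : BinTree} : Codes p σ τ →
      Codes (0 :: p) (a :: σ) (node (leaf a) τ)
  | fork {p q : List ℤ} {σ ρ : List ℕ} {s t : BinTree} : Codes p σ s → Codes q ρ t →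
      σ.headD 0 < ρ.headD 0 → Codes (negRev p ++ -1 :: q) (σ.reverse ++ ρ) (node s t)

/-- The first step selects the rule of `Codes`. In the fork case the down-step at the first return
supplies the inequality between the first labels of the two pieces. -/
theorem exists_codes {p : List ℤ} {σ : List ℕ} (hp : IsMotzkinWord p) (hc : Compat p σ) :
    ∃ τ, Codes p σ τ := by
  induction hl : p.length using Nat.strong_induction_on generalizing p σ with
  | _ m ih =>
    match p, σ, hc with
    | [], _, _ => exact absurd rfl hp.ne_nil
    | x :: r, a :: b :: σ, hc =>
      rcases hp.steps x List.mem_cons_self with rfl | rfl | rfl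
      · rcases r with _ | ⟨y, r⟩
        · match σ, hc with
          | [], hc => exact ⟨_, .cherry (hc.1.1 rfl)⟩
        · have := hp.nonneg 1 (by simp)
          simp at this
      · obtain ⟨τ, hτ⟩ := ih r.length (by simp [← hl]) (isMotzkinWord_zero_cons.1 hp) hc.2 rfl
        exact ⟨_, hτ.leaf a⟩
      · obtain ⟨p, q, hp', hq, hr⟩ := hp.exists_fork
        have hlen := hc.length
        have hlen' := congrArg List.length hr
        simp only [List.length_append, length_negRev, List.length_cons] at hlen' hlen
        generalize hρ : a :: b :: σ = ρ at hc
        have hρl : ρ.length = σ.length + 2 := by simp [← hρ]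
        rw [hr, ← List.take_append_drop (p.length + 1) ρ,
          compat_append (by simp; omega)] at hc
        rw [hr, ← List.take_append_drop (p.length + 1) ρ]
        generalize ρ.take (p.length + 1) = ρ₁ at hc
        generalize ρ.drop (p.length + 1) = ρ₂ at hc
        obtain ⟨hc₁, hs, hc₂⟩ := hc
        have hc₁' := hc₁.negRev
        rw [negRev_negRev] at hc₁'
        simp only [List.length_cons] at hl
        obtain ⟨τ₁, h₁⟩ := ih p.length (by omega) hp' hc₁' rfl
        obtain ⟨τ₂, h₂⟩ := ih q.length (by omega) hq hc₂ rfl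
        have h := h₁.fork h₂ (hs.1 rfl)
        rw [List.reverse_reverse] at h
        exact ⟨_, h⟩

theorem Codes.leafLabels_eq {p : List ℤ} {σ : List ℕ} {τ : BinTree} (h : Codes p σ τ) :
    τ.leafLabels = (σ : Multiset ℕ) := by
  induction h with
  | cherry => rfl
  | leaf a _ ih => simp [ih]
  | fork _ _ _ ih₁ ih₂ => simp [ih₁, ih₂, ← Multiset.coe_add]

theorem Codes.exists_eq_node {p : List ℤ} {σ : List ℕ} {τ : BinTree} (h : Codes p σ τ) :
    ∃ s t, τ = node s t := by
  cases h <;> exact ⟨_, _, rfl⟩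

theorem Codes.ne_leaf {p : List ℤ} {σ : List ℕ} {τ : BinTree} (h : Codes p σ τ) (a : ℕ) :
    τ ≠ BinTree.leaf a := by
  obtain ⟨s, t, rfl⟩ := h.exists_eq_node
  exact node_ne_leaf _ _ _

theorem Codes.isMotzkinWord {p : List ℤ} {σ : List ℕ} {τ : BinTree} (h : Codes p σ τ) :
    IsMotzkinWord p := by
  induction h with
  | cherry => exact isMotzkinWord_singleton
  | leaf a _ ih => exact isMotzkinWord_zero_cons.2 ih
  | fork _ _ _ ih₁ ih₂ => exact ih₁.fork ih₂

theorem Codes.compat {p : List ℤ} {σ : List ℕ} {τ : BinTree} (h : Codes p σ τ) :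
    Compat p σ := by
  induction h with
  | cherry h => exact ⟨⟨fun _ => h, by simp⟩, trivial⟩
  | @leaf a p σ τ _ ih =>
    match σ, ih with
    | b :: σ, ih => exact ⟨⟨by simp, by simp⟩, ih⟩
    | [], ih => cases p <;> exact ih
  | fork _ _ h ih₁ ih₂ =>
    refine (compat_append (by simpa using ih₁.length)).2 ⟨ih₁.negRev, ?_, ih₂⟩
    rw [List.reverse_reverse]
    exact ⟨fun _ => h, by simp⟩

theorem Codes.headD_mem {p : List ℤ} {σ : List ℕ} {τ : BinTree} (h : Codes p σ τ) :
    σ.headD 0 ∈ τ.leafLabels := by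
  rw [h.leafLabels_eq]
  have := h.compat.length
  cases σ with
  | nil => simp at this
  | cons a σ => simp

/-- The freedom to exchange children is used to put first the smaller of two leaves, or the only
leaf, or the subtree whose code has the smaller first label. -/
theorem exists_codes_of_nodup {τ : BinTree} (hτ : τ.leafLabels.Nodup) :
    (∃ a, τ = leaf a) ∨ ∃ p σ, Codes p σ τ := by
  induction τ using BinTree.induction with
  | leaf a => exact .inl ⟨a, rfl⟩
  | node s t hs ht =>
    refine .inr ?_
    have hdis : ∀ x, x ∈ s.leafLabels → x ∉ t.leafLabels := fun x =>
      Multiset.disjoint_left.1 (disjoint_of_nodup_node hτ)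
    rcases hs (nodup_left hτ) with ⟨a, rfl⟩ | ⟨p, σ, h₁⟩ <;>
      rcases ht (nodup_right hτ) with ⟨b, rfl⟩ | ⟨q, ρ, h₂⟩
    · have hab : a ≠ b := by simpa using hdis a
      rcases hab.lt_or_gt with h | h
      · exact ⟨_, _, .cherry h⟩
      · rw [node_comm]
        exact ⟨_, _, .cherry h⟩
    · exact ⟨_, _, h₂.leaf a⟩
    · rw [node_comm]
      exact ⟨_, _, h₁.leaf b⟩
    · have hne : σ.headD 0 ≠ ρ.headD 0 := fun h =>
        hdis _ h₁.headD_mem (h ▸ h₂.headD_mem)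
      rcases hne.lt_or_gt with h | h
      · exact ⟨_, _, h₁.fork h₂ h⟩
      · rw [node_comm]
        exact ⟨_, _, h₂.fork h₁ h⟩

/-- The number of leaves among the children of the root tells which rule was used last. The strict
inequalities in `cherry` and `fork` then exclude an exchange of the two children. -/
theorem Codes.unique {p q : List ℤ} {σ ρ : List ℕ} {τ : BinTree} (hτ : τ.leafLabels.Nodup)
    (h : Codes p σ τ) (h' : Codes q ρ τ) : p = q ∧ σ = ρ := by
  induction h generalizing q ρ with
  | @cherry a b hab =>
    generalize hυ : node (BinTree.leaf a) (BinTree.leaf b) = υ at h'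
    cases h' with
    | @cherry c d hcd =>
      rcases node_eq_node.1 hυ with ⟨h₁, h₂⟩ | ⟨h₁, h₂⟩ <;> rw [leaf_inj] at h₁ h₂
      · simp [h₁, h₂]
      · omega
    | leaf c h =>
      rcases node_eq_node.1 hυ with ⟨-, h₂⟩ | ⟨h₂, -⟩ <;> exact absurd h₂.symm (h.ne_leaf _)
    | fork h₁ h₂ =>
      rcases node_eq_node.1 hυ with ⟨h, -⟩ | ⟨-, h⟩ <;> exact absurd h.symm (h₁.ne_leaf _)
  | @leaf a p σ τ h ih =>
    generalize hυ : node (BinTree.leaf a) τ = υ at h'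
    cases h' with
    | @cherry c d hcd =>
      rcases node_eq_node.1 hυ with ⟨-, h₂⟩ | ⟨-, h₂⟩ <;> exact absurd h₂ (h.ne_leaf _)
    | leaf c h' =>
      rcases node_eq_node.1 hυ with ⟨h₁, rfl⟩ | ⟨-, h₂⟩
      · obtain ⟨rfl, rfl⟩ := ih (nodup_right hτ) h'
        rw [leaf_inj] at h₁
        exact ⟨rfl, by rw [h₁]⟩
      · exact absurd h₂ (h.ne_leaf _)
    | fork h₁ h₂ =>
      rcases node_eq_node.1 hυ with ⟨h, -⟩ | ⟨h, -⟩
      · exact absurd h.symm (h₁.ne_leaf _)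
      · exact absurd h.symm (h₂.ne_leaf _)
  | @fork p₁ p₂ σ₁ σ₂ s t h₁ h₂ hlt ih₁ ih₂ =>
    generalize hυ : node s t = υ at h'
    cases h' with
    | cherry hcd =>
      rcases node_eq_node.1 hυ with ⟨h, -⟩ | ⟨h, -⟩ <;> exact absurd h (h₁.ne_leaf _)
    | leaf c h' =>
      rcases node_eq_node.1 hυ with ⟨h, -⟩ | ⟨-, h⟩
      · exact absurd h (h₁.ne_leaf _)
      · exact absurd h (h₂.ne_leaf _)
    | fork k₁ k₂ hlt' =>
      rcases node_eq_node.1 hυ with ⟨rfl, rfl⟩ | ⟨rfl, rfl⟩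
      · obtain ⟨rfl, rfl⟩ := ih₁ (nodup_left hτ) k₁
        obtain ⟨rfl, rfl⟩ := ih₂ (nodup_right hτ) k₂
        exact ⟨rfl, rfl⟩
      · obtain ⟨rfl, rfl⟩ := ih₁ (nodup_left hτ) k₂
        obtain ⟨rfl, rfl⟩ := ih₂ (nodup_right hτ) k₁
        omega

/-! ### Single leaves -/

theorem singleLeaves_subset (τ : BinTree) : τ.singleLeaves ⊆ {x | x ∈ τ.leafLabels} := by
  rintro a ⟨s, t, h⟩
  exact h.mem_leafLabels (by simp)

theorem finite_singleLeaves (τ : BinTree) : τ.singleLeaves.Finite :=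
  τ.leafLabels.finite_toSet.subset (singleLeaves_subset τ)

@[simp] theorem singleLeaves_leaf (b : ℕ) : (leaf b).singleLeaves = ∅ := by
  ext a
  simp [singleLeaves, isVertex_leaf]

theorem mem_singleLeaves_node {s t : BinTree} {a : ℕ} :
    a ∈ (node s t).singleLeaves ↔ (s = leaf a ∧ ∃ u v, t = node u v) ∨
      (t = leaf a ∧ ∃ u v, s = node u v) ∨ a ∈ s.singleLeaves ∨ a ∈ t.singleLeaves := by
  simp only [singleLeaves, Set.mem_ofPred_eq, isVertex_node, node_eq_node]
  constructor
  · rintro ⟨u, v, (⟨h, h'⟩ | ⟨h, h'⟩) | h | h⟩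
    · exact .inl ⟨h.symm, _, _, h'.symm⟩
    · exact .inr (.inl ⟨h.symm, _, _, h'.symm⟩)
    · exact .inr (.inr (.inl ⟨_, _, h⟩))
    · exact .inr (.inr (.inr ⟨_, _, h⟩))
  · rintro (⟨rfl, u, v, rfl⟩ | ⟨rfl, u, v, rfl⟩ | ⟨u, v, h⟩ | ⟨u, v, h⟩)
    · exact ⟨u, v, .inl (.inl ⟨rfl, rfl⟩)⟩
    · exact ⟨u, v, .inl (.inr ⟨rfl, rfl⟩)⟩
    · exact ⟨u, v, .inr (.inl h)⟩
    · exact ⟨u, v, .inr (.inr h)⟩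

/-- A coded tree is never a leaf, so the rule `leaf` creates one single leaf along with its letter
`0`, and the other rules create neither. -/
theorem Codes.ncard_singleLeaves {p : List ℤ} {σ : List ℕ} {τ : BinTree}
    (hτ : τ.leafLabels.Nodup) (h : Codes p σ τ) : τ.singleLeaves.ncard = p.count 0 := by
  induction h with
  | @cherry a b _ =>
    have : (node (BinTree.leaf a) (BinTree.leaf b)).singleLeaves = ∅ := by
      ext x
      simp [mem_singleLeaves_node]
    simp [this]
  | @leaf a p σ τ h ih =>
    have hs : (node (BinTree.leaf a) τ).singleLeaves = insert a τ.singleLeaves := by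
      ext x
      obtain ⟨s, t, hst⟩ := h.exists_eq_node
      rw [mem_singleLeaves_node, Set.mem_insert_iff]
      simp [hst, eq_comm]
    have ha : a ∉ τ.singleLeaves := fun h =>
      Multiset.disjoint_left.1 (disjoint_of_nodup_node hτ) (by simp : a ∈ _)
        (singleLeaves_subset τ h)
    rw [hs, Set.ncard_insert_of_notMem ha (finite_singleLeaves τ), ih (nodup_right hτ)]
    simp
  | @fork p q σ ρ s t h₁ h₂ _ ih₁ ih₂ =>
    have hs : (node s t).singleLeaves = s.singleLeaves ∪ t.singleLeaves := by
      ext x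
      rw [mem_singleLeaves_node, Set.mem_union]
      simp [h₁.ne_leaf, h₂.ne_leaf]
    have hd : Disjoint s.singleLeaves t.singleLeaves := Set.disjoint_left.2 fun x hx hx' =>
      Multiset.disjoint_left.1 (disjoint_of_nodup_node hτ) (singleLeaves_subset s hx)
        (singleLeaves_subset t hx')
    rw [hs, Set.ncard_union_eq hd (finite_singleLeaves s) (finite_singleLeaves t),
      ih₁ (nodup_left hτ), ih₂ (nodup_right hτ), List.count_append, count_zero_negRev]
    simp

/-! ### The computation of `Φ` -/

theorem lam_lamInv {I : Finset ℕ} {x : ℕ} (hx : x ∈ I) : lam I (lamInv I x) = x := by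
  simpa [lam, lamInv] using Nat.nth_count (p := (· ∈ I)) hx

theorem lamInv_le_card {I : Finset ℕ} {x : ℕ} (hx : x ∈ I) : lamInv I x ≤ I.card := by
  rw [lamInv, Nat.count_eq_card_filter_range, Nat.succ_le_iff]
  refine Finset.card_lt_card ⟨fun y hy => (Finset.mem_filter.1 hy).2, fun h => ?_⟩
  simpa using h hx

/-- The ranks are different by `lam_lamInv` and at most `σ.length`, so they exhaust the interval. -/
theorem perm_map_lamInv {σ : List ℕ} (hσ : σ.Nodup) :
    (σ.map (lamInv σ.toFinset)).Perm (List.range' 1 σ.length) := by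
  refine ((hσ.map_on fun x hx y hy h => ?_).subperm fun y hy => ?_).perm_of_length_le (by simp)
  · rw [← lam_lamInv (List.mem_toFinset.2 hx), h, lam_lamInv (List.mem_toFinset.2 hy)]
  · obtain ⟨x, hx, rfl⟩ := List.mem_map.1 hy
    have h := lamInv_le_card (List.mem_toFinset.2 hx)
    rw [List.toFinset_card_of_nodup hσ] at h
    rw [List.mem_range'_1]
    simp only [lamInv] at *
    omega

theorem PhiAux_cherry (σ : List ℕ) : PhiAux [-1] σ = node (leaf 1) (leaf 2) := by
  rw [PhiAux, if_pos rfl]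

theorem PhiAux_zero_cons (q : List ℤ) (a : ℕ) (σ : List ℕ) :
    PhiAux (0 :: q) (a :: σ) =
      let J := (Finset.Icc 1 (σ.length + 1)).erase a
      node (leaf a) (relabel (lam J) (PhiAux q (σ.map (lamInv J)))) := by
  rw [PhiAux, if_neg (by simp), if_pos rfl]
  rfl

/-- The search in `PhiAux` stops at `p.length + 1`, by the heights computed above; cutting there
gives back `p` (reversed twice), `q` and the two words of labels. -/
theorem PhiAux_fork {p : List ℤ} (q : List ℤ) {σ : List ℕ} (ρ : List ℕ) (hp : IsMotzkinWord p)
    (hσ : σ.length = p.length + 1) :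
    PhiAux (negRev p ++ -1 :: q) (σ.reverse ++ ρ) =
      node (relabel (lam σ.toFinset) (PhiAux p (σ.map (lamInv σ.toFinset))))
        (relabel (lam ρ.toFinset) (PhiAux q (ρ.map (lamInv ρ.toFinset)))) := by
  obtain ⟨r, hr⟩ := hp.exists_fork_eq_cons q
  have h₀ := hp.sum_take_fork_add (q := q) 0
  have hlt := fun j => hp.one_le_sum_take_fork (q := q) (j := j)
  have hlen := congrArg List.length hr
  have h₁ : (1 :: r).take p.length = negRev p := by rw [← hr, List.take_left' (by simp)]
  have h₂ : (1 :: r).drop (p.length + 1) = q := by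
    rw [← hr, List.drop_append, length_negRev, Nat.add_sub_cancel_left,
      List.drop_of_length_le (by simp)]
    rfl
  have h₃ : (σ.reverse ++ ρ).take (p.length + 1) = σ.reverse := List.take_left' (by simpa)
  have h₄ : (σ.reverse ++ ρ).drop (p.length + 1) = ρ := List.drop_left' (by simpa)
  rw [hr] at h₀ hlt
  simp only [List.length_append, length_negRev, List.length_cons] at hlen
  simp only [Nat.add_zero, List.take_zero, List.sum_nil] at h₀
  have hex : (1 : ℤ) = 1 ∧ ∃ k, 1 ≤ k ∧ k ≤ (1 :: r).length ∧ ((1 :: r).take k).sum = 0 :=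
    ⟨rfl, p.length + 1, by omega, by simp only [List.length_cons]; omega, h₀⟩
  rw [hr, PhiAux, if_neg (by simp), if_neg one_ne_zero, dif_pos hex]
  classical
  have hk : Nat.find hex.2 = p.length + 1 := by
    rw [Nat.find_eq_iff]
    refine ⟨⟨by omega, by simp only [List.length_cons]; omega, h₀⟩, fun j hj h => ?_⟩
    have := hlt j h.1 (by omega)
    omega
  -- The `Nat.find` in `PhiAux` may carry another decidability instance, so its value is stated for
  -- all of them.
  have hk' : ∀ inst : DecidablePred fun k =>
      1 ≤ k ∧ k ≤ (1 :: r).length ∧ ((1 :: r).take k).sum = 0,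
      @Nat.find _ inst hex.2 = p.length + 1 := fun inst => by
    rw [← hk]
    congr
  simp only [hk', Nat.add_sub_cancel, h₁, h₂, h₃, h₄, List.reverse_reverse,
    List.toFinset_reverse]
  rw [← negRev, negRev_negRev]

/-- Standardising by `lamInv` and restoring by `lam` cancel once `ih` is applied to `g = lamInv _ ∘
f`. -/
theorem relabel_lam_PhiAux {p : List ℤ} {σ : List ℕ} {τ : BinTree} {f : ℕ → ℕ}
    (hσ : τ.leafLabels = (σ : Multiset ℕ)) (hf : (σ.map f).Nodup)
    (ih : ∀ g : ℕ → ℕ, (σ.map g).Perm (List.range' 1 σ.length) →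
      PhiAux p (σ.map g) = relabel g τ) :
    relabel (lam (σ.map f).toFinset) (PhiAux p ((σ.map f).map (lamInv (σ.map f).toFinset))) =
      relabel f τ := by
  have h := perm_map_lamInv hf
  rw [List.length_map, List.map_map] at h
  rw [List.map_map, ih _ h, relabel_relabel]
  refine relabel_congr fun x hx => lam_lamInv ?_
  rw [hσ, Multiset.mem_coe] at hx
  exact List.mem_toFinset.2 (List.mem_map_of_mem hx)

/-- A general `f` is needed because the recursion replaces labels by their ranks. It need not be
increasing: `PhiAux` uses the order of labels only in standardisations, which cancel. -/
theorem Codes.PhiAux_map {p : List ℤ} {σ : List ℕ} {τ : BinTree} (h : Codes p σ τ) (f : ℕ → ℕ)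
    (hf : (σ.map f).Perm (List.range' 1 σ.length)) : PhiAux p (σ.map f) = relabel f τ := by
  have hnd : (σ.map f).Nodup := hf.nodup_iff.2 List.nodup_range'
  induction h generalizing f with
  | @cherry a b _ =>
    -- The labels are sent to `1` and `2` in one order or the other; the children are unordered, so
    -- both are fine.
    have h₁ : 1 ∈ [a, b].map f := hf.mem_iff.2 (by simp)
    have h₂ : 2 ∈ [a, b].map f := hf.mem_iff.2 (by simp)
    rw [PhiAux_cherry, relabel_node, relabel_leaf, relabel_leaf, node_eq_node]
    simp at h₁ h₂ ⊢
    omega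
  | @leaf a p σ τ h ih =>
    have hJ : (Finset.Icc 1 ((σ.map f).length + 1)).erase (f a) = (σ.map f).toFinset := by
      ext x
      have hx := hf.mem_iff (a := x)
      rw [List.map_cons, List.nodup_cons] at hnd
      rw [List.map_cons, List.mem_cons, List.mem_range'_1, List.length_cons] at hx
      rw [Finset.mem_erase, Finset.mem_Icc, List.length_map, List.mem_toFinset]
      constructor
      · rintro ⟨h₁, h₂⟩
        exact (hx.2 ⟨h₂.1, by omega⟩).resolve_left h₁
      · intro h₁
        have h₂ := hx.1 (.inr h₁)
        exact ⟨fun h => hnd.1 (h ▸ h₁), h₂.1, by omega⟩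
    rw [List.map_cons, PhiAux_zero_cons]
    simp only [hJ]
    rw [List.map_cons, List.nodup_cons] at hnd
    rw [relabel_lam_PhiAux h.leafLabels_eq hnd.2 fun g hg =>
      ih g hg (hg.nodup_iff.2 List.nodup_range'), relabel_node, relabel_leaf]
  | @fork p q σ ρ s t h₁ h₂ _ ih₁ ih₂ =>
    rw [List.map_append, List.map_reverse] at hnd ⊢
    rw [List.nodup_append, List.nodup_reverse] at hnd
    rw [PhiAux_fork q _ h₁.isMotzkinWord (by simpa using h₁.compat.length),
      relabel_lam_PhiAux h₁.leafLabels_eq hnd.1 fun g hg =>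
        ih₁ g hg (hg.nodup_iff.2 List.nodup_range'),
      relabel_lam_PhiAux h₂.leafLabels_eq hnd.2.1 fun g hg =>
        ih₂ g hg (hg.nodup_iff.2 List.nodup_range'), relabel_node]

/-! ### Bijectivity of `Φ`. -/

theorem coe_range'_one (n : ℕ) : ((List.range' 1 n : List ℕ) : Multiset ℕ) = (Finset.Icc 1 n).val :=
  rfl

theorem Codes.Phi_eq {n : ℕ} {P : LPath} {τ : BinTree} (h : Codes P.p P.σ τ)
    (hσ : P.σ.Perm (List.range' 1 n)) : Phi P = τ := by
  have hn : P.σ.length = n := by simpa using hσ.length_eq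
  have := h.PhiAux_map id (by simpa [hn] using hσ)
  rwa [List.map_id, relabel_id] at this

theorem Codes.isLabelled_iff {n : ℕ} {p : List ℤ} {σ : List ℕ} {τ : BinTree}
    (h : Codes p σ τ) : IsLabelled n τ ↔ σ.Perm (List.range' 1 n) := by
  rw [IsLabelled, h.leafLabels_eq, ← coe_range'_one, Multiset.coe_eq_coe]

theorem IsMotzkin.codes_Phi {n : ℕ} {P : LPath} (hP : IsMotzkin n P) :
    Codes P.p P.σ (Phi P) ∧ IsLabelled n (Phi P) := by
  obtain ⟨-, hp, hc, hσ⟩ := isMotzkin_iff.1 hP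
  obtain ⟨τ, hτ⟩ := exists_codes hp hc
  rw [hτ.Phi_eq hσ]
  exact ⟨hτ, hτ.isLabelled_iff.2 hσ⟩

theorem bijOn_Phi (n k : ℕ) (hn : 2 ≤ n) :
    Set.BijOn Phi (motzkinPaths n k) (labelledTrees n k) := by
  refine ⟨?_, ?_, ?_⟩
  · rintro P ⟨hP, hk⟩
    obtain ⟨hc, hl⟩ := hP.codes_Phi
    exact ⟨hl, (hc.ncard_singleLeaves hl.nodup).trans hk⟩
  · rintro P ⟨hP, -⟩ Q ⟨hQ, -⟩ h
    obtain ⟨hc, hl⟩ := hP.codes_Phi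
    obtain ⟨hc', -⟩ := hQ.codes_Phi
    obtain ⟨h₁, h₂⟩ := hc.unique hl.nodup (h ▸ hc')
    exact LPath.ext h₁ h₂
  · rintro τ ⟨hl, hk⟩
    rcases exists_codes_of_nodup hl.nodup with ⟨a, rfl⟩ | ⟨p, σ, hc⟩
    · have := hl.card
      simp at this
      omega
    · have hσ := hc.isLabelled_iff.1 hl
      have hlen := hc.compat.length
      have hlen' := hσ.length_eq
      rw [List.length_range'] at hlen'
      exact ⟨⟨p, σ⟩, ⟨isMotzkin_iff.2 ⟨by simp only; omega, hc.isMotzkinWord, hc.compat, hσ⟩,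
        (hc.ncard_singleLeaves hl.nodup).symm.trans hk⟩, Codes.Phi_eq hc hσ⟩

/-! ### Greedy sequences of pairs -/

/-- The vertices of a fully labelled tree with `n` leaves are labelled by `1, …, 2 * n - 1`, the
root being labelled `2 * n - 1`. The children of the internal vertex `v` have labels
`a v < b v`, and `v` was chosen by the labelling procedure since `a v` is as small as possible. -/
structure Greedy (n : ℕ) (a b : ℕ → ℕ) : Prop where
  one_le : ∀ v, n < v → v < 2 * n → 1 ≤ a v
  lt : ∀ v, n < v → v < 2 * n → a v < b v
  lt_parent : ∀ v, n < v → v < 2 * n → b v < v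
  inj_left : ∀ v w, n < v → v < 2 * n → n < w → w < 2 * n → a v = a w → v = w
  inj_right : ∀ v w, n < v → v < 2 * n → n < w → w < 2 * n → b v = b w → v = w
  ne : ∀ v w, n < v → v < 2 * n → n < w → w < 2 * n → a v ≠ b w
  lt_of_lt : ∀ v w, n < v → v < w → w < 2 * n → b w < v → a v < a w

/-- `L j` is the subtree hanging at the vertex labelled `j`. -/
structure IsForest (n : ℕ) (a b : ℕ → ℕ) (L : ℕ → BinTree) : Prop where
  leaf : ∀ v, 1 ≤ v → v ≤ n → L v = BinTree.leaf v
  node : ∀ v, n < v → v < 2 * n → L v = BinTree.node (L (a v)) (L (b v))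

section Greedy

variable {n : ℕ} {a b : ℕ → ℕ} {L : ℕ → BinTree}

-- The `n - 1` internal vertices have `2 * (n - 1)` different children, all in `[2n - 2]`: every
-- label except that of the root is the label of a child.
open Finset in
theorem Greedy.image_union_image (h : Greedy n a b) (hn : 1 ≤ n) :
    Disjoint ((Ioo n (2 * n)).image a) ((Ioo n (2 * n)).image b) ∧
    (Ioo n (2 * n)).image a ∪ (Ioo n (2 * n)).image b = Icc 1 (2 * n - 2) := by
  have hd : Disjoint ((Ioo n (2 * n)).image a) ((Ioo n (2 * n)).image b) := by
    rw [disjoint_left]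
    intro x hx hx'
    obtain ⟨v, hv, rfl⟩ := mem_image.1 hx
    obtain ⟨w, hw, hvw⟩ := mem_image.1 hx'
    rw [mem_Ioo] at hv hw
    exact h.ne v w hv.1 hv.2 hw.1 hw.2 hvw.symm
  refine ⟨hd, eq_of_subset_of_card_le ?_ ?_⟩
  · intro x hx
    rw [mem_union, mem_image, mem_image] at hx
    rw [mem_Icc]
    rcases hx with ⟨v, hv, rfl⟩ | ⟨v, hv, rfl⟩ <;> rw [mem_Ioo] at hv <;>
      have h₁ := h.one_le v hv.1 hv.2 <;> have h₂ := h.lt v hv.1 hv.2 <;>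
      have h₃ := h.lt_parent v hv.1 hv.2 <;> omega
  · rw [card_union_of_disjoint hd, card_image_of_injOn, card_image_of_injOn, Nat.card_Icc,
      Nat.card_Ioo]
    · omega
    · intro v hv w hw
      rw [coe_Ioo, Set.mem_Ioo] at hv hw
      exact h.inj_right v w hv.1 hv.2 hw.1 hw.2
    · intro v hv w hw
      rw [coe_Ioo, Set.mem_Ioo] at hv hw
      exact h.inj_left v w hv.1 hv.2 hw.1 hw.2

theorem Greedy.cover (h : Greedy n a b) {j : ℕ} (hj : 1 ≤ j) (hj' : j + 1 < 2 * n) :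
    ∃ v, n < v ∧ v < 2 * n ∧ (j = a v ∨ j = b v) := by
  have h₁ : j ∈ Finset.Icc 1 (2 * n - 2) := Finset.mem_Icc.2 ⟨hj, by omega⟩
  rw [← (h.image_union_image (by omega)).2, Finset.mem_union, Finset.mem_image,
    Finset.mem_image] at h₁
  rcases h₁ with ⟨v, hv, rfl⟩ | ⟨v, hv, rfl⟩ <;> rw [Finset.mem_Ioo] at hv
  · exact ⟨v, hv.1, hv.2, .inl rfl⟩
  · exact ⟨v, hv.1, hv.2, .inr rfl⟩

/-- Greedy sequences are determined by their sets of pairs. -/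
theorem Greedy.unique {a' b' : ℕ → ℕ} (h : Greedy n a b) (h' : Greedy n a' b')
    (hp : ∀ v, n < v → v < 2 * n → ∃ w, n < w ∧ w < 2 * n ∧ a v = a' w ∧ b v = b' w)
    (hp' : ∀ v, n < v → v < 2 * n → ∃ w, n < w ∧ w < 2 * n ∧ a' v = a w ∧ b' v = b w) :
    ∀ v, n < v → v < 2 * n → a v = a' v ∧ b v = b' v := by
  intro v
  induction v using Nat.strong_induction_on with
  | _ v ih =>
    intro hv hv'
    obtain ⟨w, hw, hw', hwa, hwb⟩ := hp v hv hv'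
    obtain ⟨u, hu, hu', hua, hub⟩ := hp' v hv hv'
    have h₁ := h.lt_parent v hv hv'
    have h₂ := h'.lt_parent v hv hv'
    -- An earlier `w` is impossible: the sequences agree there by induction, and the first one would
    -- use the same pair twice.
    rcases lt_trichotomy w v with hwv | rfl | hwv
    · have := h.inj_left v w hv hv' hw hw' (by rw [hwa, (ih w hwv hw hw').1])
      omega
    · exact ⟨hwa, hwb⟩
    rcases lt_trichotomy u v with huv | rfl | huv
    · have := h'.inj_left v u hv hv' hu hu' (by rw [hua, (ih u huv hu hu').1])
      omega
    · exact ⟨hua.symm, hub.symm⟩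
    -- Each sequence postpones the pair taken by the other at `v`, although both its elements are
    -- below `v`. Greediness gives `a v < a' v` and `a' v < a v`.
    · have h₃ := h.lt_of_lt v u hv huv hu' (by omega)
      have h₄ := h'.lt_of_lt v w hv hwv hw' (by omega)
      omega

/-! ### Trees built from greedy sequences. -/

theorem IsForest.unique {a' b' : ℕ → ℕ} {L' : ℕ → BinTree} (h : Greedy n a b)
    (hL : IsForest n a b L) (hL' : IsForest n a' b' L')
    (hab : ∀ v, n < v → v < 2 * n → a v = a' v ∧ b v = b' v) :
    ∀ v, 1 ≤ v → v < 2 * n → L v = L' v := by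
  intro v
  induction v using Nat.strong_induction_on with
  | _ v ih =>
    intro hv hv'
    rcases Nat.lt_or_ge n v with hnv | hnv
    · have h₁ := h.one_le v hnv hv'
      have h₂ := h.lt v hnv hv'
      have h₃ := h.lt_parent v hnv hv'
      rw [hL.node v hnv hv', hL'.node v hnv hv', ← (hab v hnv hv').1, ← (hab v hnv hv').2,
        ih _ (h₂.trans h₃) h₁ (by omega), ih _ h₃ (by omega) (by omega)]
    · rw [hL.leaf v hv hnv, hL'.leaf v hv hnv]

theorem Greedy.exists_isForest (h : Greedy n a b) : ∃ L, IsForest n a b L := by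
  have key : ∀ m ≤ 2 * n, ∃ L : ℕ → BinTree, (∀ v, 1 ≤ v → v ≤ n → L v = BinTree.leaf v) ∧
      ∀ v, n < v → v < m → L v = BinTree.node (L (a v)) (L (b v)) := by
    intro m
    induction m with
    | zero => exact fun _ => ⟨BinTree.leaf, fun _ _ _ => rfl, fun _ _ h => absurd h (by omega)⟩
    | succ m ih =>
      intro hm
      obtain ⟨L, hL, hL'⟩ := ih (by omega)
      rcases Nat.lt_or_ge n m with hnm | hnm
      · refine ⟨Function.update L m (BinTree.node (L (a m)) (L (b m))), fun v hv hv' => ?_,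
          fun v hv hv' => ?_⟩
        · rw [Function.update_of_ne (by omega), hL v hv hv']
        · have h₂ := h.lt v hv (by omega)
          have h₃ := h.lt_parent v hv (by omega)
          rw [Function.update_of_ne (show a v ≠ m by omega),
            Function.update_of_ne (show b v ≠ m by omega)]
          rcases (Nat.lt_succ_iff.1 hv').eq_or_lt with rfl | hvm
          · rw [Function.update_self]
          · rw [Function.update_of_ne hvm.ne, hL' v hv hvm]
      · exact ⟨L, hL, fun v hv hv' => absurd hv (by omega)⟩
  obtain ⟨L, hL, hL'⟩ := key (2 * n) le_rfl
  exact ⟨L, hL, hL'⟩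

theorem IsForest.injective (h : Greedy n a b) (hL : IsForest n a b L) :
    ∀ v w, 1 ≤ v → v < 2 * n → 1 ≤ w → w < 2 * n → L v = L w → v = w := by
  intro v
  induction v using Nat.strong_induction_on with
  | _ v ih =>
    intro w hv hv' hw hw' hvw
    rcases Nat.lt_or_ge n v with hnv | hnv <;> rcases Nat.lt_or_ge n w with hnw | hnw
    · have h₁ := h.one_le v hnv hv'
      have h₂ := h.lt v hnv hv'
      have h₃ := h.lt_parent v hnv hv'
      have k₁ := h.one_le w hnw hw'
      have k₂ := h.lt w hnw hw'
      have k₃ := h.lt_parent w hnw hw'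
      rw [hL.node v hnv hv', hL.node w hnw hw'] at hvw
      rcases node_eq_node.1 hvw with ⟨e, -⟩ | ⟨e, -⟩ <;>
        have := ih _ (h₂.trans h₃) _ h₁ (by omega) (by omega) (by omega) e
      · exact h.inj_left v w hnv hv' hnw hw' this
      · exact absurd this (h.ne v w hnv hv' hnw hw')
    · rw [hL.node v hnv hv', hL.leaf w hw hnw] at hvw
      exact absurd hvw (node_ne_leaf _ _ _)
    · rw [hL.leaf v hv hnv, hL.node w hnw hw'] at hvw
      exact absurd hvw (leaf_ne_node _ _ _)
    · rwa [hL.leaf v hv hnv, hL.leaf w hw hnw, leaf_inj] at hvw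

theorem IsForest.exists_of_isVertex (h : Greedy n a b) (hL : IsForest n a b L) {u : BinTree} :
    ∀ v, 1 ≤ v → v < 2 * n → IsVertex u (L v) → ∃ w, 1 ≤ w ∧ w ≤ v ∧ u = L w := by
  intro v
  induction v using Nat.strong_induction_on with
  | _ v ih =>
    intro hv hv' hu
    rcases Nat.lt_or_ge n v with hnv | hnv
    · have h₁ := h.one_le v hnv hv'
      have h₂ := h.lt v hnv hv'
      have h₃ := h.lt_parent v hnv hv'
      rw [hL.node v hnv hv', isVertex_node, ← hL.node v hnv hv'] at hu
      rcases hu with hu | hu | hu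
      · exact ⟨v, hv, le_rfl, hu⟩
      · obtain ⟨w, hw, hw', e⟩ := ih _ (h₂.trans h₃) h₁ (by omega) hu
        exact ⟨w, hw, by omega, e⟩
      · obtain ⟨w, hw, hw', e⟩ := ih _ h₃ (by omega) (by omega) hu
        exact ⟨w, hw, by omega, e⟩
    · rw [hL.leaf v hv hnv, isVertex_leaf, ← hL.leaf v hv hnv] at hu
      exact ⟨v, hv, le_rfl, hu⟩

/-- Climbing from child to parent by `Greedy.cover` increases the label until the root is reached.
-/
theorem IsForest.isVertex (h : Greedy n a b) (hL : IsForest n a b L) {v : ℕ} (hv : 1 ≤ v)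
    (hv' : v < 2 * n) : IsVertex (L v) (L (2 * n - 1)) := by
  induction hd : 2 * n - v using Nat.strong_induction_on generalizing v with
  | _ d ih =>
    rcases Nat.lt_or_ge (v + 1) (2 * n) with hlt | hge
    · obtain ⟨w, hnw, hw', hvw⟩ := h.cover hv hlt
      have h₂ := h.lt w hnw hw'
      have h₃ := h.lt_parent w hnw hw'
      have hw := ih (2 * n - w) (by omega) (by omega) hw' rfl
      refine IsVertex.trans ?_ hw
      rw [hL.node w hnw hw']
      rcases hvw with rfl | rfl
      · exact isVertex_left_child _ _
      · exact isVertex_right_child _ _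
    · obtain rfl : v = 2 * n - 1 := by omega
      exact .root _

theorem IsForest.isVertex_node_iff (h : Greedy n a b) (hL : IsForest n a b L) (hn : 1 ≤ n)
    {s t : BinTree} : IsVertex (BinTree.node s t) (L (2 * n - 1)) ↔ ∃ v, n < v ∧ v < 2 * n ∧
      ((s = L (a v) ∧ t = L (b v)) ∨ (s = L (b v) ∧ t = L (a v))) := by
  constructor
  · intro hu
    obtain ⟨w, hw, hw', e⟩ := hL.exists_of_isVertex h _ (by omega) (by omega) hu
    rcases Nat.lt_or_ge n w with hnw | hnw
    · rw [hL.node w hnw (by omega), node_eq_node] at e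
      exact ⟨w, hnw, by omega, e⟩
    · rw [hL.leaf w hw hnw] at e
      exact absurd e (node_ne_leaf _ _ _)
  · rintro ⟨v, hv, hv', e⟩
    have := hL.isVertex h (by omega) hv'
    rwa [hL.node v hv hv', ← node_eq_node.2 e] at this

-- The leaves of an internal vertex are those of its two children, and the children are all vertices
-- but the root. So the leaf multisets have the same sum over internal vertices as over non-root
-- vertices; comparing with the sum over all vertices leaves `1, …, n` for the root.
open Finset in
theorem IsForest.isLabelled (h : Greedy n a b) (hL : IsForest n a b L) (hn : 1 ≤ n) :
    IsLabelled n (L (2 * n - 1)) := by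
  have h₁ : ∑ j ∈ Icc 1 n, (L j).leafLabels = (Icc 1 n).val := by
    rw [sum_congr rfl fun j hj => by
      rw [hL.leaf j (mem_Icc.1 hj).1 (mem_Icc.1 hj).2, leafLabels_leaf]]
    exact sum_multiset_singleton _
  have h₂ : ∑ j ∈ Ioo n (2 * n), (L j).leafLabels =
      ∑ j ∈ Icc 1 (2 * n - 2), (L j).leafLabels := by
    obtain ⟨hd, hu⟩ := h.image_union_image hn
    rw [← hu, sum_union hd, sum_image, sum_image, ← sum_add_distrib]
    · refine sum_congr rfl fun v hv => ?_
      rw [mem_Ioo] at hv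
      rw [hL.node v hv.1 hv.2, leafLabels_node]
    · intro v hv w hw
      rw [coe_Ioo, Set.mem_Ioo] at hv hw
      exact h.inj_right v w hv.1 hv.2 hw.1 hw.2
    · intro v hv w hw
      rw [coe_Ioo, Set.mem_Ioo] at hv hw
      exact h.inj_left v w hv.1 hv.2 hw.1 hw.2
  have h₃ : Icc 1 n ∪ Ioo n (2 * n) = insert (2 * n - 1) (Icc 1 (2 * n - 2)) := by
    ext x
    simp only [mem_union, mem_Icc, mem_Ioo, mem_insert]
    omega
  have h₄ : Disjoint (Icc 1 n) (Ioo n (2 * n)) := by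
    rw [disjoint_left]
    intro x hx hx'
    rw [mem_Icc] at hx
    rw [mem_Ioo] at hx'
    omega
  have h₅ := congrArg (fun s => ∑ j ∈ s, (L j).leafLabels) h₃
  rw [sum_union h₄, sum_insert (by rw [mem_Icc]; omega), h₁, h₂] at h₅
  exact (add_right_cancel h₅).symm

/-! ### The labelling procedure -/

/-- The ready vertices are the unlabelled non-root `L w` with `b w < m`, and the least label below
`L w` is `a w`. Among them is `L m`, and `lt_of_lt` says that it has the least `a w`. -/
theorem IsForest.isNext_iff (h : Greedy n a b) (hL : IsForest n a b L) {m : ℕ} (hm : n < m)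
    (hm' : m + 1 < 2 * n) {ℓ : BinTree → Option ℕ}
    (hℓ : ∀ w, 1 ≤ w → w < 2 * n → ℓ (L w) = if w < m then some w else none) (v : BinTree) :
    IsNext (L (2 * n - 1)) ℓ v ↔ v = L m := by
  have hsome : ∀ w x, 1 ≤ w → w < 2 * n → ℓ (L w) = some x → w = x ∧ w < m := by
    intro w x hw hw' e
    rw [hℓ w hw hw'] at e
    split_ifs at e with hlt
    exact ⟨Option.some_inj.1 e, hlt⟩
  have hready : ∀ v x, Ready (L (2 * n - 1)) ℓ v x ↔
      ∃ w, m ≤ w ∧ w + 1 < 2 * n ∧ v = L w ∧ b w < m ∧ x = a w := by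
    intro v x
    constructor
    · rintro ⟨hv, hne, hnone, s, t, y, z, rfl, hs, ht, rfl⟩
      obtain ⟨w, hw, hw', e⟩ := (hL.isVertex_node_iff h (by omega)).1 hv
      have h₁ := h.one_le w hw hw'
      have h₂ := h.lt w hw hw'
      have h₃ := h.lt_parent w hw hw'
      have e' : BinTree.node s t = L w := by rw [hL.node w hw hw', node_eq_node.2 e]
      rw [e', hℓ w (by omega) hw'] at hnone
      have hwm : m ≤ w := by
        by_contra hlt
        simp [not_le.1 hlt] at hnone
      have hwn : w ≠ 2 * n - 1 := by
        rintro rfl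
        exact hne e'
      refine ⟨w, hwm, by omega, e', ?_⟩
      rcases e with ⟨rfl, rfl⟩ | ⟨rfl, rfl⟩
      · have k₁ := hsome _ _ h₁ (by omega) hs
        have k₂ := hsome _ _ (by omega) (by omega) ht
        omega
      · have k₁ := hsome _ _ (by omega) (by omega) hs
        have k₂ := hsome _ _ (by omega) (by omega) ht
        omega
    · rintro ⟨w, hw, hw', rfl, hb, rfl⟩
      have h₁ := h.one_le w (by omega) (by omega)
      have h₂ := h.lt w (by omega) (by omega)
      refine ⟨hL.isVertex h (by omega) (by omega), fun e => ?_, ?_, L (a w), L (b w), a w, b w,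
        hL.node w (by omega) (by omega), ?_, ?_, by omega⟩
      · have := hL.injective h _ _ (by omega) (by omega) (by omega) (by omega) e
        omega
      · rw [hℓ w (by omega) (by omega), if_neg (by omega)]
      · rw [hℓ _ (by omega) (by omega), if_pos (by omega)]
      · rw [hℓ _ (by omega) (by omega), if_pos (by omega)]
  constructor
  · rintro ⟨x, hv, hmin⟩
    obtain ⟨w, hw, hw', rfl, hb, rfl⟩ := (hready v x).1 hv
    have hle := hmin (L m) (a m)
      ((hready _ _).2 ⟨m, le_rfl, hm', rfl, h.lt_parent m hm (by omega), rfl⟩)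
    rcases hw.eq_or_lt with rfl | hlt
    · rfl
    · have := h.lt_of_lt m w hm hlt (by omega) hb
      omega
  · rintro rfl
    refine ⟨a m, (hready _ _).2 ⟨m, le_rfl, hm', rfl, h.lt_parent m hm (by omega), rfl⟩,
      fun v' x hv' => ?_⟩
    obtain ⟨w, hw, hw', rfl, hb, rfl⟩ := (hready v' x).1 hv'
    rcases hw.eq_or_lt with rfl | hlt
    · exact le_rfl
    · exact (h.lt_of_lt m w hm hlt (by omega) hb).le

theorem IsForest.labelling_eq (h : Greedy n a b) (hL : IsForest n a b L) :
    ∀ i, i + 2 ≤ n → ∀ w, 1 ≤ w → w < 2 * n →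
      labelling n (L (2 * n - 1)) i (L w) = if w < n + 1 + i then some w else none := by
  classical
  intro i
  induction i with
  | zero =>
    intro _ w hw hw'
    rw [labelling]
    rcases Nat.lt_or_ge n w with hnw | hnw
    · rw [hL.node w hnw hw', rootLabel_node, if_neg (by omega)]
    · rw [hL.leaf w hw hnw, rootLabel_leaf, if_pos (by omega)]
  | succ i ih =>
    intro hi w hw hw'
    have hnext := hL.isNext_iff h (m := n + 1 + i) (by omega) (by omega) (ih (by omega))
    have hex : ∃ v, IsNext (L (2 * n - 1)) (labelling n (L (2 * n - 1)) i) v :=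
      ⟨_, (hnext _).2 rfl⟩
    rw [labelling, dif_pos hex, (hnext _).1 hex.choose_spec]
    by_cases hwi : w = n + 1 + i
    · rw [hwi, Function.update_self, if_pos (by omega)]
    · rw [Function.update_of_ne, ih (by omega) w hw hw']
      · split_ifs <;> first | rfl | omega
      · exact fun e => hwi (hL.injective h _ _ hw hw' (by omega) (by omega) e)

theorem IsForest.fullLabelling_eq_some_iff (h : Greedy n a b) (hL : IsForest n a b L)
    (hn : 2 ≤ n) {w x : ℕ} (hw : 1 ≤ w) (hw' : w + 1 < 2 * n) :
    fullLabelling n (L (2 * n - 1)) (L w) = some x ↔ x = w := by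
  -- After `n - 2` steps the labels below `n + 1 + (n - 2) = 2 * n - 1` are attributed, that is, all
  -- but that of the root.
  rw [fullLabelling, hL.labelling_eq h _ (by omega) w hw (by omega), if_pos (by omega),
    Option.some_inj, eq_comm]

theorem IsForest.siblingLabels_iff (h : Greedy n a b) (hL : IsForest n a b L) (hn : 2 ≤ n)
    {i j : ℕ} : SiblingLabels n (L (2 * n - 1)) i j ↔
      ∃ v, n < v ∧ v < 2 * n ∧ ((i = a v ∧ j = b v) ∨ (i = b v ∧ j = a v)) := by
  have hf : ∀ v, n < v → v < 2 * n → ∀ x,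
      (fullLabelling n (L (2 * n - 1)) (L (a v)) = some x ↔ x = a v) ∧
      (fullLabelling n (L (2 * n - 1)) (L (b v)) = some x ↔ x = b v) := by
    intro v hv hv' x
    have h₁ := h.one_le v hv hv'
    have h₂ := h.lt v hv hv'
    have h₃ := h.lt_parent v hv hv'
    exact ⟨hL.fullLabelling_eq_some_iff h hn h₁ (by omega),
      hL.fullLabelling_eq_some_iff h hn (by omega) (by omega)⟩
  constructor
  · rintro ⟨s, t, hst, hs, ht⟩
    obtain ⟨v, hv, hv', e⟩ := (hL.isVertex_node_iff h (by omega)).1 hst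
    refine ⟨v, hv, hv', ?_⟩
    rcases e with ⟨rfl, rfl⟩ | ⟨rfl, rfl⟩
    · exact .inl ⟨(hf v hv hv' i).1.1 hs, (hf v hv hv' j).2.1 ht⟩
    · exact .inr ⟨(hf v hv hv' i).2.1 hs, (hf v hv hv' j).1.1 ht⟩
  · rintro ⟨v, hv, hv', ⟨rfl, rfl⟩ | ⟨rfl, rfl⟩⟩
    · exact ⟨_, _, (hL.isVertex_node_iff h (by omega)).2 ⟨v, hv, hv', .inl ⟨rfl, rfl⟩⟩,
        (hf v hv hv' _).1.2 rfl, (hf v hv hv' _).2.2 rfl⟩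
    · exact ⟨_, _, (hL.isVertex_node_iff h (by omega)).2 ⟨v, hv, hv', .inr ⟨rfl, rfl⟩⟩,
        (hf v hv hv' _).2.2 rfl, (hf v hv hv' _).1.2 rfl⟩

/-- Leaves have the labels up to `n`, so a leaf with an internal sibling is the child with the
smaller label. -/
theorem IsForest.mem_singleLeaves_iff (h : Greedy n a b) (hL : IsForest n a b L) (hn : 1 ≤ n)
    {x : ℕ} : x ∈ (L (2 * n - 1)).singleLeaves ↔
      ∃ v, n < v ∧ v < 2 * n ∧ x = a v ∧ a v ≤ n ∧ n < b v := by
  have hleaf : ∀ w, 1 ≤ w → w < 2 * n → ∀ y, BinTree.leaf y = L w → y = w ∧ w ≤ n := by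
    intro w hw hw' y e
    rcases Nat.lt_or_ge n w with hnw | hnw
    · rw [hL.node w hnw hw'] at e
      exact absurd e (leaf_ne_node _ _ _)
    · rw [hL.leaf w hw hnw, leaf_inj] at e
      exact ⟨e, hnw⟩
  have hnode : ∀ w, 1 ≤ w → w < 2 * n → ∀ s t, BinTree.node s t = L w → n < w := by
    intro w hw hw' s t e
    by_contra hnw
    rw [hL.leaf w hw (not_lt.1 hnw)] at e
    exact node_ne_leaf _ _ _ e
  constructor
  · rintro ⟨s, t, hst⟩
    obtain ⟨v, hv, hv', e⟩ := (hL.isVertex_node_iff h hn).1 hst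
    have h₁ := h.one_le v hv hv'
    have h₂ := h.lt v hv hv'
    have h₃ := h.lt_parent v hv hv'
    rcases e with ⟨e, e'⟩ | ⟨e, e'⟩
    · have k₁ := hleaf _ h₁ (by omega) _ e
      exact ⟨v, hv, hv', k₁.1, k₁.2, hnode _ (by omega) (by omega) _ _ e'⟩
    · have k₁ := hleaf _ (by omega) (by omega) _ e
      have k₂ := hnode _ h₁ (by omega) _ _ e'
      omega
  · rintro ⟨v, hv, hv', rfl, ha, hb⟩
    have h₁ := h.one_le v hv hv'
    have h₃ := h.lt_parent v hv hv'
    refine ⟨L (a (b v)), L (b (b v)),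
      (hL.isVertex_node_iff h hn).2 ⟨v, hv, hv', .inl ⟨?_, ?_⟩⟩⟩
    · rw [hL.leaf _ h₁ ha]
    · rw [hL.node (b v) hb (by omega)]

end Greedy

/-! ### Existence of greedy sequences -/

open Finset in
/-- The pairs of a matching form a greedy sequence. -/
theorem exists_greedy_of_involution {n : ℕ} {p : ℕ → ℕ}
    (hp : ∀ x, 1 ≤ x → x + 1 < 2 * n → 1 ≤ p x ∧ p x + 1 < 2 * n ∧ p (p x) = x ∧ p x ≠ x) :
    ∃ a b, Greedy n a b ∧ ∀ v, n < v → v < 2 * n → p (a v) = b v := by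
  -- At each `v`, `a v` is the least unused `x` with `x < p x < v`.
  have key : ∀ m, n < m → m ≤ 2 * n → ∃ a : ℕ → ℕ, ∀ v, n < v → v < m →
      1 ≤ a v ∧ a v < p (a v) ∧ p (a v) < v ∧ (∀ w, n < w → w < v → a w ≠ a v) ∧
      ∀ x, 1 ≤ x → x < p x → p x < v → (∀ w, n < w → w < v → a w ≠ x) → a v ≤ x := by
    intro m hm
    induction m, hm using Nat.le_induction with
    | base => exact fun _ => ⟨id, fun v hv hv' => absurd hv (by omega)⟩
    | succ m hm ih =>
      intro hm'
      obtain ⟨a, ha⟩ := ih (by omega)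
      have hex : ∃ x, 1 ≤ x ∧ x < p x ∧ p x < m ∧ ∀ w, n < w → w < m → a w ≠ x := by
        by_contra! hno
        -- If no pair below `m` were unused, then `[m - 1]` would be covered by the `2 * (m - n -
        -- 1)` elements already used and the partners of the `2 * n - 1 - m` elements from `m` on,
        -- that is, by at most `m - 3` elements.
        have hsub : Icc 1 (m - 1) ⊆ ((Ioo n m).image a ∪ (Ioo n m).image fun w => p (a w)) ∪
            (Icc m (2 * n - 2)).image p := by
          intro x hx
          rw [mem_Icc] at hx
          obtain ⟨h₁, h₂, h₃, h₄⟩ := hp x hx.1 (by omega)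
          rw [mem_union, mem_union, mem_image, mem_image, mem_image]
          rcases Nat.lt_or_ge (p x) m with hlt | hge
          · left
            rcases h₄.lt_or_gt with h | h
            · obtain ⟨w, hw, hw', e⟩ := hno (p x) h₁ (by rwa [h₃]) (by omega)
              exact .inr ⟨w, mem_Ioo.2 ⟨hw, hw'⟩, by rw [e, h₃]⟩
            · obtain ⟨w, hw, hw', e⟩ := hno x hx.1 h hlt
              exact .inl ⟨w, mem_Ioo.2 ⟨hw, hw'⟩, e⟩
          · exact .inr ⟨p x, mem_Icc.2 ⟨hge, by omega⟩, h₃⟩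
        have h₁ := card_le_card hsub
        have h₂ := card_union_le ((Ioo n m).image a ∪ (Ioo n m).image fun w => p (a w))
          ((Icc m (2 * n - 2)).image p)
        have h₃ := card_union_le ((Ioo n m).image a) ((Ioo n m).image fun w => p (a w))
        have h₄ := card_image_le (s := Ioo n m) (f := a)
        have h₅ := card_image_le (s := Ioo n m) (f := fun w => p (a w))
        have h₆ := card_image_le (s := Icc m (2 * n - 2)) (f := p)
        rw [Nat.card_Icc] at h₁ h₆
        rw [Nat.card_Ioo] at h₄ h₅
        omega
      classical
      obtain ⟨h₁, h₂, h₃, h₄⟩ := Nat.find_spec hex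
      have hmin := fun y => Nat.find_min' hex (m := y)
      generalize Nat.find hex = x at h₁ h₂ h₃ h₄ hmin
      refine ⟨Function.update a m x, fun v hv hv' => ?_⟩
      have hne : ∀ w, w < v → Function.update a m x w = a w := fun w hw =>
        Function.update_of_ne (by omega) _ _
      rcases (Nat.lt_succ_iff.1 hv').eq_or_lt with rfl | hvm
      · rw [Function.update_self]
        refine ⟨h₁, h₂, h₃, fun w hw hw' => ?_, fun y hy hy' hyv h => hmin y ⟨hy, hy', hyv, ?_⟩⟩
        · rw [hne w hw']
          exact h₄ w hw hw'
        · intro w hw hw'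
          rw [← hne w hw']
          exact h w hw hw'
      · rw [Function.update_of_ne hvm.ne]
        obtain ⟨k₁, k₂, k₃, k₄, k₅⟩ := ha v hv hvm
        refine ⟨k₁, k₂, k₃, fun w hw hw' => ?_, fun y hy hy' hyv h => k₅ y hy hy' hyv ?_⟩
        · rw [hne w hw']
          exact k₄ w hw hw'
        · intro w hw hw'
          rw [← hne w hw']
          exact h w hw hw'
  rcases Nat.eq_zero_or_pos n with rfl | hn
  · exact ⟨id, id, by constructor <;> intros <;> omega, by intros; omega⟩
  obtain ⟨a, ha⟩ := key (2 * n) (by omega) le_rfl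
  have hinj : ∀ v w, n < v → v < 2 * n → n < w → w < 2 * n → a v = a w → v = w := by
    intro v w hv hv' hw hw' e
    rcases lt_trichotomy v w with h | h | h
    · exact absurd e ((ha w hw hw').2.2.2.1 v hv h)
    · exact h
    · exact absurd e.symm ((ha v hv hv').2.2.2.1 w hw h)
  have hpp : ∀ v, n < v → v < 2 * n → p (p (a v)) = a v := by
    intro v hv hv'
    obtain ⟨h₁, h₂, h₃, -⟩ := ha v hv hv'
    exact (hp (a v) h₁ (by omega)).2.2.1
  refine ⟨a, fun v => p (a v), ⟨fun v hv hv' => (ha v hv hv').1,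
    fun v hv hv' => (ha v hv hv').2.1, fun v hv hv' => (ha v hv hv').2.2.1, hinj, ?_, ?_, ?_⟩,
    fun _ _ _ => rfl⟩
  · intro v w hv hv' hw hw' e
    refine hinj v w hv hv' hw hw' ?_
    rw [← hpp v hv hv', ← hpp w hw hw']
    exact congrArg p e
  · intro v w hv hv' hw hw' e
    have h₁ := (ha v hv hv').2.1
    have h₂ := (ha w hw hw').2.1
    rw [e, hpp w hw hw'] at h₁
    omega
  · intro v w hv hvw hw hlt
    obtain ⟨h₁, h₂, h₃, -⟩ := ha w (by omega) hw
    have hne : ∀ u, n < u → u < w → a u ≠ a w := fun u hu hu' e => by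
      have := hinj u w hu (by omega) (by omega) hw e
      omega
    -- The pair taken at `w` was already available at `v`, where the least choice was made.
    have := (ha v hv (by omega)).2.2.2.2 (a w) h₁ h₂ hlt fun u hu hu' => hne u hu (by omega)
    have := hne v hv hvw
    omega

/-- The labelling procedure of a labelled tree gives a greedy sequence. -/
theorem exists_greedy_of_isLabelled {n : ℕ} {τ : BinTree} (hτ : IsLabelled n τ) :
    ∃ a b L, Greedy n a b ∧ IsForest n a b L ∧ L (2 * n - 1) = τ := by
  classical
  have hn : 1 ≤ n := by
    rw [← hτ.card]
    exact τ.leafLabels_card_pos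
  obtain ⟨V, hV, hVc⟩ := exists_finset_vertices hτ.nodup
  rw [hτ.card] at hVc
  -- Unlike in `Ready`, the root may be chosen; it is shown at the end to come last.
  have key : ∀ m, n < m → m ≤ 2 * n → ∃ (a b : ℕ → ℕ) (L : ℕ → BinTree),
      (∀ v, 1 ≤ v → v ≤ n → L v = leaf v) ∧ (∀ v, 1 ≤ v → v < m → IsVertex (L v) τ) ∧
      (∀ v w, 1 ≤ v → v < w → w < m → L v ≠ L w) ∧ ∀ v, n < v → v < m →
      1 ≤ a v ∧ a v < b v ∧ b v < v ∧ L v = node (L (a v)) (L (b v)) ∧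
      ∀ x y, 1 ≤ x → x < y → y < v → IsVertex (node (L x) (L y)) τ →
        (∀ w, 1 ≤ w → w < v → L w ≠ node (L x) (L y)) → a v ≤ x := by
    intro m hm
    induction m, hm using Nat.le_induction with
    | base =>
      refine fun _ => ⟨id, id, leaf, fun _ _ _ => rfl, fun v hv hv' => ?_, fun v w _ h _ e => ?_,
        fun v hv hv' => absurd hv (by omega)⟩
      · exact isVertex_of_mem_leafLabels ((hτ.mem_iff v).2 ⟨hv, by omega⟩)
      · exact h.ne (leaf_injective e)
    | succ m hm ih =>
      intro hm'
      obtain ⟨a, b, L, hleaf, hvert, hinj, hstep⟩ := ih (by omega)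
      have hex : ∃ x, 1 ≤ x ∧ ∃ y, x < y ∧ y < m ∧ IsVertex (node (L x) (L y)) τ ∧
          ∀ w, 1 ≤ w → w < m → L w ≠ node (L x) (L y) := by
        -- Only `m - 1` of the `2 * n - 1` vertices are labelled. An unlabelled one with the fewest
        -- leaves is internal and has labelled children.
        have hnew : ∃ d u, IsVertex u τ ∧ (∀ w, 1 ≤ w → w < m → L w ≠ u) ∧
            u.leafLabels.card = d := by
          by_contra! hno
          have hsub : V ⊆ (Finset.Ico 1 m).image L := by
            intro u hu
            by_contra hu'
            refine hno _ u ((hV u).1 hu) (fun w hw hw' e => hu' ?_) rfl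
            exact Finset.mem_image.2 ⟨w, Finset.mem_Ico.2 ⟨hw, hw'⟩, e⟩
          have h₁ := (Finset.card_le_card hsub).trans Finset.card_image_le
          rw [Nat.card_Ico] at h₁
          omega
        obtain ⟨u, hu, hu', hcard⟩ := Nat.find_spec hnew
        have hlab : ∀ v, IsVertex v τ → v.leafLabels.card < u.leafLabels.card →
            ∃ w, 1 ≤ w ∧ w < m ∧ L w = v := by
          intro v hv hlt
          by_contra! hno
          exact Nat.find_min hnew (hcard ▸ hlt) ⟨v, hv, hno, rfl⟩
        clear hcard
        induction u using BinTree.induction with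
        | leaf x =>
          have hx := (hτ.mem_iff x).1 (hu.mem_leafLabels (by simp))
          exact absurd (hleaf x hx.1 hx.2) (hu' x hx.1 (by omega))
        | node s t =>
          have hs := s.leafLabels_card_pos
          have ht := t.leafLabels_card_pos
          rw [leafLabels_node, Multiset.card_add] at hlab
          obtain ⟨x, hx, hxm, rfl⟩ := hlab s ((isVertex_left_child _ _).trans hu) (by omega)
          obtain ⟨y, hy, hym, rfl⟩ := hlab t ((isVertex_right_child _ _).trans hu) (by omega)
          have hxy : x ≠ y := by
            rintro rfl
            exact not_isVertex_both (Multiset.nodup_of_le hu.leafLabels_le hτ.nodup)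
              (.root _) (.root _)
          rcases hxy.lt_or_gt with h | h
          · exact ⟨x, hx, y, h, hym, hu, hu'⟩
          · rw [node_comm] at hu hu'
            exact ⟨y, hy, x, h, hxm, hu, hu'⟩
      have hmin := fun z => Nat.find_min' hex (m := z)
      obtain ⟨hx, y, hxy, hym, hxyV, hxyN⟩ := Nat.find_spec hex
      generalize Nat.find hex = x at hx hxy hxyV hxyN hmin
      have hL : ∀ w, w < m → Function.update L m (node (L x) (L y)) w = L w := fun w hw =>
        Function.update_of_ne (by omega) _ _
      refine ⟨Function.update a m x, Function.update b m y,
        Function.update L m (node (L x) (L y)), fun v hv hv' => ?_, fun v hv hv' => ?_,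
        fun v w hv hvw hw => ?_, fun v hv hv' => ?_⟩
      · rw [hL v (by omega), hleaf v hv hv']
      · rcases (Nat.lt_succ_iff.1 hv').eq_or_lt with rfl | hvm
        · rwa [Function.update_self]
        · rw [hL v hvm]
          exact hvert v hv hvm
      · rw [hL v (by omega)]
        rcases (Nat.lt_succ_iff.1 hw).eq_or_lt with rfl | hwm
        · rw [Function.update_self]
          exact hxyN v hv hvw
        · rw [hL w hwm]
          exact hinj v w hv hvw hwm
      · have hcongr : ∀ z z', z < z' → z' < v →
            IsVertex (node (Function.update L m (node (L x) (L y)) z)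
              (Function.update L m (node (L x) (L y)) z')) τ →
            (∀ w, 1 ≤ w → w < v → Function.update L m (node (L x) (L y)) w ≠
              node (Function.update L m (node (L x) (L y)) z)
                (Function.update L m (node (L x) (L y)) z')) →
            IsVertex (node (L z) (L z')) τ ∧
              ∀ w, 1 ≤ w → w < v → L w ≠ node (L z) (L z') := by
          intro z z' hz hz' h h'
          rw [hL z (by omega), hL z' (by omega)] at h h'
          refine ⟨h, fun w hw hw' => ?_⟩
          rw [← hL w (by omega)]
          exact h' w hw hw'
        rcases (Nat.lt_succ_iff.1 hv').eq_or_lt with rfl | hvm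
        · rw [Function.update_self, Function.update_self, hL x (by omega), hL y hym,
            Function.update_self]
          refine ⟨hx, hxy, hym, rfl, fun z z' hz hzz' hz' h h' => ?_⟩
          obtain ⟨k, k'⟩ := hcongr z z' hzz' hz' h h'
          exact hmin z ⟨hz, z', hzz', hz', k, k'⟩
        · obtain ⟨k₁, k₂, k₃, k₄, k₅⟩ := hstep v hv hvm
          rw [Function.update_of_ne hvm.ne, Function.update_of_ne hvm.ne, hL v hvm,
            hL (a v) (by omega), hL (b v) (by omega)]
          refine ⟨k₁, k₂, k₃, k₄, fun z z' hz hzz' hz' h h' => ?_⟩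
          obtain ⟨k, k'⟩ := hcongr z z' hzz' hz' h h'
          exact k₅ z z' hz hzz' hz' k k'
  obtain ⟨a, b, L, hleaf, hvert, hinj, hstep⟩ := key (2 * n) (by omega) le_rfl
  have hinj' : ∀ v w, 1 ≤ v → v < 2 * n → 1 ≤ w → w < 2 * n → L v = L w → v = w := by
    intro v w hv hv' hw hw' e
    rcases lt_trichotomy v w with h | h | h
    · exact absurd e (hinj v w hv h hw')
    · exact h
    · exact absurd e.symm (hinj w v hw h hv')
  have hnode : ∀ v, n < v → v < 2 * n → IsVertex (node (L (a v)) (L (b v))) τ := by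
    intro v hv hv'
    rw [← (hstep v hv hv').2.2.2.1]
    exact hvert v (by omega) hv'
  -- Internal vertices with a common child coincide; this yields `inj_left`, `inj_right` and `ne`.
  have heq : ∀ v w x y, n < v → v < 2 * n → n < w → w < 2 * n →
      L v = node (L x) (L y) → ∀ z, L w = node (L x) z → v = w := by
    intro v w x y hv hv' hw hw' e z e'
    have h₁ := hvert v (by omega) hv'
    have h₂ := hvert w (by omega) hw'
    rw [e] at h₁
    rw [e'] at h₂
    refine hinj' v w (by omega) hv' (by omega) hw' ?_
    rw [e, e', IsVertex.sibling_unique hτ.nodup h₁ h₂]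
  have ha : ∀ v w, n < v → v < 2 * n → n < w → w < 2 * n → a v = a w → v = w := by
    intro v w hv hv' hw hw' e
    exact heq v w _ _ hv hv' hw hw' (hstep v hv hv').2.2.2.1 _ (e ▸ (hstep w hw hw').2.2.2.1)
  have hgreedy : Greedy n a b := by
    refine ⟨fun v hv hv' => (hstep v hv hv').1, fun v hv hv' => (hstep v hv hv').2.1,
      fun v hv hv' => (hstep v hv hv').2.2.1, ha, ?_, ?_, ?_⟩
    · intro v w hv hv' hw hw' e
      refine heq v w _ _ hv hv' hw hw' ((hstep v hv hv').2.2.2.1.trans (node_comm _ _))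
        (L (a w)) ?_
      rw [e]
      exact (hstep w hw hw').2.2.2.1.trans (node_comm _ _)
    · intro v w hv hv' hw hw' e
      have := heq v w _ _ hv hv' hw hw' (hstep v hv hv').2.2.2.1 (L (a w)) (by
        rw [e]
        exact (hstep w hw hw').2.2.2.1.trans (node_comm _ _))
      subst this
      have := (hstep v hv hv').2.1
      omega
    · intro v w hv hvw hw hlt
      obtain ⟨k₁, k₂, -, k₄, -⟩ := hstep w (by omega) hw
      have := (hstep v hv (by omega)).2.2.2.2 (a w) (b w) k₁ k₂ hlt (hnode w (by omega) hw)
        fun u hu hu' => by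
          rw [← k₄]
          exact hinj u w hu (by omega) hw
      have hne : a v ≠ a w := fun e => hvw.ne (ha v w hv (by omega) (by omega) hw e)
      omega
  have hforest : IsForest n a b L := ⟨hleaf, fun v hv hv' => (hstep v hv hv').2.2.2.1⟩
  refine ⟨a, b, L, hgreedy, hforest, ?_⟩
  -- By counting, `L` reaches every vertex, so `τ = L v` for some `v`. As `L (2 * n - 1)` is a
  -- vertex of `L v`, its label is at most `v`, whence `v = 2 * n - 1`.
  have hsub : (Finset.Ico 1 (2 * n)).image L ⊆ V := by
    intro u hu
    obtain ⟨v, hv, rfl⟩ := Finset.mem_image.1 hu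
    rw [Finset.mem_Ico] at hv
    exact (hV _).2 (hvert v hv.1 hv.2)
  have himage : (Finset.Ico 1 (2 * n)).image L = V := by
    refine Finset.eq_of_subset_of_card_le hsub ?_
    rw [Finset.card_image_of_injOn, Nat.card_Ico]
    · omega
    · intro v hv w hw
      rw [Finset.coe_Ico, Set.mem_Ico] at hv hw
      exact hinj' v w hv.1 hv.2 hw.1 hw.2
  obtain ⟨v, hv, hvτ⟩ := Finset.mem_image.1 (himage.symm ▸ (hV τ).2 (.root τ))
  rw [Finset.mem_Ico] at hv
  have hroot := hvert (2 * n - 1) (by omega) (by omega)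
  rw [← hvτ] at hroot
  obtain ⟨w, hw, hwv, e⟩ := hforest.exists_of_isVertex hgreedy v hv.1 hv.2 hroot
  have := hinj' _ _ (by omega) (by omega) hw (by omega) e
  rw [← hvτ, show v = 2 * n - 1 by omega]

/-! ### The mapping `Ψ` -/

section Psi

variable {n : ℕ} {a b : ℕ → ℕ} {L : ℕ → BinTree}

/-- Each label lies in exactly one pair, so the choice in `Psi` is forced and its default value `i`
never occurs. -/
theorem IsForest.Psi_eq_iff (h : Greedy n a b) (hL : IsForest n a b L) (hn : 2 ≤ n)
    {i j : Set.Icc 1 (2 * n - 2)} : Psi n (L (2 * n - 1)) i = j ↔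
      ∃ v, n < v ∧ v < 2 * n ∧ (((i : ℕ) = a v ∧ (j : ℕ) = b v) ∨
        ((i : ℕ) = b v ∧ (j : ℕ) = a v)) := by
  have huniq : ∀ j' : Set.Icc 1 (2 * n - 2), SiblingLabels n (L (2 * n - 1)) i j →
      SiblingLabels n (L (2 * n - 1)) i j' → j = j' := by
    intro j' hj hj'
    obtain ⟨v, hv, hv', e⟩ := (hL.siblingLabels_iff h hn).1 hj
    obtain ⟨w, hw, hw', e'⟩ := (hL.siblingLabels_iff h hn).1 hj'
    apply Subtype.ext
    rcases e with ⟨e₁, e₂⟩ | ⟨e₁, e₂⟩ <;> rcases e' with ⟨e₃, e₄⟩ | ⟨e₃, e₄⟩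
    · rw [e₂, e₄, h.inj_left v w hv hv' hw hw' (e₁.symm.trans e₃)]
    · exact absurd (e₁.symm.trans e₃) (h.ne v w hv hv' hw hw')
    · exact absurd (e₃.symm.trans e₁) (h.ne w v hw hw' hv hv')
    · rw [e₂, e₄, h.inj_right v w hv hv' hw hw' (e₁.symm.trans e₃)]
  rw [← hL.siblingLabels_iff h hn]
  constructor
  · rintro rfl
    have hi := i.2
    rw [Set.mem_Icc] at hi
    have hex : ∃ j : Set.Icc 1 (2 * n - 2), SiblingLabels n (L (2 * n - 1)) i j := by
      obtain ⟨v, hv, hv', e⟩ := h.cover hi.1 (by omega)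
      have h₁ := h.one_le v hv hv'
      have h₂ := h.lt v hv hv'
      have h₃ := h.lt_parent v hv hv'
      rcases e with e | e
      · exact ⟨⟨b v, Set.mem_Icc.2 (by omega)⟩,
          (hL.siblingLabels_iff h hn).2 ⟨v, hv, hv', .inl ⟨e, rfl⟩⟩⟩
      · exact ⟨⟨a v, Set.mem_Icc.2 (by omega)⟩,
          (hL.siblingLabels_iff h hn).2 ⟨v, hv, hv', .inr ⟨e, rfl⟩⟩⟩
    rw [Psi, dif_pos hex]
    exact hex.choose_spec
  · intro hj
    have hex : ∃ j : Set.Icc 1 (2 * n - 2), SiblingLabels n (L (2 * n - 1)) i j := ⟨j, hj⟩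
    rw [Psi, dif_pos hex]
    exact (huniq _ hj hex.choose_spec).symm

theorem IsForest.isMatching_Psi (h : Greedy n a b) (hL : IsForest n a b L) (hn : 2 ≤ n) :
    IsMatching (2 * n - 2) (Psi n (L (2 * n - 1))) := by
  constructor
  · intro i
    obtain ⟨v, hv, hv', e⟩ := (hL.Psi_eq_iff h hn (i := i)).1 rfl
    exact (hL.Psi_eq_iff h hn).2 ⟨v, hv, hv', by tauto⟩
  · intro i hi
    obtain ⟨v, hv, hv', e⟩ := (hL.Psi_eq_iff h hn).1 hi
    have := h.lt v hv hv'
    omega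

/-- A cross pair is determined by its first element, which is the label `a v` of a leaf whose
sibling has label `b v > n`. -/
theorem IsForest.ncard_crossPairs_Psi (h : Greedy n a b) (hL : IsForest n a b L) (hn : 2 ≤ n) :
    (crossPairs n (2 * n - 2) (Psi n (L (2 * n - 1)))).ncard =
      (L (2 * n - 1)).singleLeaves.ncard := by
  have himage : (L (2 * n - 1)).singleLeaves = (fun q => (q.1 : ℕ)) ''
      crossPairs n (2 * n - 2) (Psi n (L (2 * n - 1))) := by
    ext x
    rw [hL.mem_singleLeaves_iff h (by omega), Set.mem_image]
    constructor
    · rintro ⟨v, hv, hv', rfl, ha, hb⟩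
      have h₁ := h.one_le v hv hv'
      have h₃ := h.lt_parent v hv hv'
      exact ⟨(⟨a v, Set.mem_Icc.2 (by omega)⟩, ⟨b v, Set.mem_Icc.2 (by omega)⟩),
        ⟨(hL.Psi_eq_iff h hn).2 ⟨v, hv, hv', .inl ⟨rfl, rfl⟩⟩, ha, hb⟩, rfl⟩
    · rintro ⟨⟨i, j⟩, ⟨hij, hi, hj⟩, rfl⟩
      obtain ⟨v, hv, hv', e⟩ := (hL.Psi_eq_iff h hn (i := i) (j := j)).1 hij
      have h₂ := h.lt v hv hv'
      replace hi : (i : ℕ) ≤ n := hi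
      replace hj : n + 1 ≤ (j : ℕ) := hj
      rcases e with ⟨e₁, e₂⟩ | ⟨e₁, e₂⟩
      · exact ⟨v, hv, hv', e₁, by omega, by omega⟩
      · omega
  rw [himage, Set.InjOn.ncard_image]
  rintro ⟨i, j⟩ ⟨hij, -⟩ ⟨i', j'⟩ ⟨hij', -⟩ e
  have : i = i' := Subtype.ext e
  subst this
  exact Prod.ext rfl (hij.symm.trans hij')

/-- Greedy sequences with the same matching have the same pairs. -/
theorem IsForest.exists_pair_eq {a' b' : ℕ → ℕ} {L' : ℕ → BinTree} (h : Greedy n a b)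
    (hL : IsForest n a b L) (h' : Greedy n a' b') (hL' : IsForest n a' b' L') (hn : 2 ≤ n)
    (e : Psi n (L (2 * n - 1)) = Psi n (L' (2 * n - 1))) (v : ℕ) (hv : n < v)
    (hv' : v < 2 * n) : ∃ w, n < w ∧ w < 2 * n ∧ a v = a' w ∧ b v = b' w := by
  have h₁ := h.one_le v hv hv'
  have h₂ := h.lt v hv hv'
  have h₃ := h.lt_parent v hv hv'
  have hij := (hL.Psi_eq_iff h hn (i := ⟨a v, Set.mem_Icc.2 (by omega)⟩)
    (j := ⟨b v, Set.mem_Icc.2 (by omega)⟩)).2 ⟨v, hv, hv', .inl ⟨rfl, rfl⟩⟩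
  rw [e] at hij
  obtain ⟨w, hw, hw', k⟩ := (hL'.Psi_eq_iff h' hn).1 hij
  have := h'.lt w hw hw'
  simp only at k
  exact ⟨w, hw, hw', by omega⟩

end Psi

theorem exists_Psi_eq {n : ℕ} (hn : 2 ≤ n)
    {π : Set.Icc 1 (2 * n - 2) → Set.Icc 1 (2 * n - 2)} (hπ : IsMatching (2 * n - 2) π) :
    ∃ a b L, Greedy n a b ∧ IsForest n a b L ∧ Psi n (L (2 * n - 1)) = π := by
  classical
  -- The matching is extended to `ℕ` by the identity.
  set p : ℕ → ℕ := fun x => if hx : x ∈ Set.Icc 1 (2 * n - 2) then π ⟨x, hx⟩ else x with hp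
  have hpi : ∀ i : Set.Icc 1 (2 * n - 2), p i = π i := fun i => by simp only [hp, dif_pos i.2]
  obtain ⟨a, b, h, hab⟩ := exists_greedy_of_involution (n := n) (p := p) (by
    intro x hx hx'
    set i : Set.Icc 1 (2 * n - 2) := ⟨x, Set.mem_Icc.2 (by omega)⟩ with hi
    have h₁ := Set.mem_Icc.1 (π i).2
    have h₂ : p x = π i := hpi i
    refine ⟨by omega, by omega, ?_, fun h => hπ.2 i (Subtype.ext (h₂.symm.trans h))⟩
    rw [h₂, hpi, hπ.1 i])
  obtain ⟨L, hL⟩ := h.exists_isForest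
  refine ⟨a, b, L, h, hL, funext fun i => (hL.Psi_eq_iff h hn).2 ?_⟩
  have hi := Set.mem_Icc.1 i.2
  obtain ⟨v, hv, hv', e⟩ := h.cover hi.1 (by omega)
  refine ⟨v, hv, hv', ?_⟩
  have h₁ := h.one_le v hv hv'
  have h₂ := h.lt v hv hv'
  have h₃ := h.lt_parent v hv hv'
  rcases e with e | e
  · exact .inl ⟨e, by rw [← hpi, e, hab v hv hv']⟩
  · refine .inr ⟨e, ?_⟩
    set j : Set.Icc 1 (2 * n - 2) := ⟨a v, Set.mem_Icc.2 (by omega)⟩ with hj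
    have hji : π j = i := Subtype.ext (by rw [← hpi, e, ← hab v hv hv'])
    rw [← hji, hπ.1 j]

/-- Equal matchings have the same pairs, `Greedy.unique` restores their order, and the ordered pairs
rebuild the tree. -/
theorem bijOn_Psi (n k : ℕ) (hn : 2 ≤ n) :
    Set.BijOn (Psi n) (labelledTrees n k) (matchings n k) := by
  refine ⟨?_, ?_, ?_⟩
  · rintro τ ⟨hτ, hk⟩
    obtain ⟨a, b, L, h, hL, rfl⟩ := exists_greedy_of_isLabelled hτ
    exact ⟨hL.isMatching_Psi h hn, (hL.ncard_crossPairs_Psi h hn).trans hk⟩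
  · rintro τ ⟨hτ, -⟩ τ' ⟨hτ', -⟩ e
    obtain ⟨a, b, L, h, hL, rfl⟩ := exists_greedy_of_isLabelled hτ
    obtain ⟨a', b', L', h', hL', rfl⟩ := exists_greedy_of_isLabelled hτ'
    exact hL.unique h hL' (h.unique h' (hL.exists_pair_eq h h' hL' hn e)
      (hL'.exists_pair_eq h' h hL hn e.symm)) _ (by omega) (by omega)
  · rintro π ⟨hπ, hk⟩
    obtain ⟨a, b, L, h, hL, rfl⟩ := exists_Psi_eq hn hπ
    exact ⟨_, ⟨hL.isLabelled h (by omega), (hL.ncard_crossPairs_Psi h hn).symm.trans hk⟩, rfl⟩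

end LabelledPaths

theorem mainTheorem7 (n k : ℕ) (hn : 2 ≤ n) :
    Set.BijOn LabelledPaths.Phi
      (LabelledPaths.motzkinPaths n k) (LabelledPaths.labelledTrees n k) ∧
    Set.BijOn (LabelledPaths.Psi n)
      (LabelledPaths.labelledTrees n k) (LabelledPaths.matchings n k) :=
  ⟨LabelledPaths.bijOn_Phi n k hn, LabelledPaths.bijOn_Psi n k hn⟩
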